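/- Let $\Phi$ be a field of characteristic different from $2$ and $3$. All algebras are over $\Phi$, nonassociative and not necessarily unital; a superalgebra is a $\mathbb Z_2$-graded algebra $A=A_0\oplus A_1$, and isomorphisms of superalgebras preserve the grading. Put $(a,b,c)=(ab)c-a(bc)$ and $[a,b]=ab-ba$. A superalgebra $A$ is Jordan (resp. strongly $(-1,1)$) if its Grassmann envelope $A_0\otimes G_0+A_1\otimes G_1$ is commutative and satisfies $(p^2,q,p)=0$ (resp. satisfies $(p,q,q)=0$, $(p,q,r)+(q,r,p)+(r,p,q)=0$ and $[[p,q],r]=0$), where $G=G_0\oplus G_1$ is the unital Grassmann algebra on countably many generators. For a set $Z$ of even generators and one odd generator $x$, let $J[Z;x]$ be the quotient of the free Jordan superalgebra $\mathrm{Jord}[Z;x]$ by the ideal generated by all $(z,a,b)+(-1)^{|a||b|}(z,b,a)$, with $z\in Z$ and $a,b\in\mathrm{Jord}[Z;x]$ homogeneous. Let $F[Z;x]$ be the quotient of the free strongly $(-1,1)$-superalgebra $F_{St}[Z;x]$ by the ideal generated by all $[z,f]$, with $z\in Z$ and $f\in F_{St}[Z;x]$. For a superalgebra $A$, let $A^{(+)}$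 be the same graded space with the product $a\bullet b=\frac12\left(ab+(-1)^{|a||b|}ba\right)$ for homogeneous $a,b$. Let $\Phi[T_Z]$ be the polynomial algebra in the variables $z_i$ ($z\in Z$, $i\ge 0$), let $D$ be its derivation with $D(z_i)=z_{i+1}$, and let $\Phi_0[T_Z]$ be the set of polynomials without constant term. The Jordan superalgebra of vector type $J(\Phi[T_Z],D)=\Phi[T_Z]\oplus\overline{\Phi[T_Z]}$ (even part $\Phi[T_Z]$, odd part a copy $\overline{\Phi[T_Z]}$) has the product $$a\bullet b=ab,\qquad a\bullet\bar b=\bar a\bullet b=\overline{ab},\qquad \bar a\bullet\bar b=D(a)b-aD(b).$$ **(1)** If $Z\ne\emptyset$, then $J[Z;x]$ is isomorphic, as a superalgebra, to the subsuperalgebra $\Phi_0[T_Z]\oplus\overline{\Phi[T_Z]}$ of $J(\Phi[T_Z],D)$, by an isomorphism with $z\mapsto z_0$ for $z\in Z$ and $x\mapsto\bar 1$. **(2)** For every set $Z$ and every $s\notin Z$ there is an isomorphism of superalgebras $\psi:J[Z\cup\{s\};x]\to F[Z;x]^{(+)}$ that sends $x$ to $x$ and acts on monomials as follows. In $J[Z\cup\{s\};x]$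 put $u_{g,i}=g\,R_{x,x}^{\,i}$ for $g\in Z\cup\{s\}$, $i\ge0$. In $F[Z;x]$ put $v_{z,i}=z\left(\tfrac14R_{x,x}\right)^{i}$ for $z\in Z$ and $v_{s,i}=x^2\left(\tfrac14R_{x,x}\right)^{i}$. Here $aR_{x,x}=(ax)x-a(xx)$, computed in the respective superalgebra. Then for all $n\ge1$, $g_1,\dots,g_n\in Z\cup\{s\}$, $i_1,\dots,i_n\ge0$ and $\varepsilon\in\{0,1\}$, $$\psi\left(u_{g_1,i_1}u_{g_2,i_2}\cdots u_{g_n,i_n}x^{\varepsilon}\right)=v_{g_1,i_1}v_{g_2,i_2}\cdots v_{g_n,i_n}x^{\varepsilon},$$ where all products are left-normed and those on the right are taken in $F[Z;x]$. -/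

import Mathlib

open scoped TensorProduct

noncomputable section

namespace VectorSuper

universe u v w

/-! ### Superalgebras -/

/-- A (nonassociative, not necessarily unital) superalgebra over `Φ`: an algebra
`A = A₀ ⊕ A₁` with `Aᵢ Aⱼ ⊆ Aᵢ₊ⱼ`. -/
class Superalgebra (Φ : Type u) (A : Type v) [Field Φ] [NonUnitalNonAssocRing A]
    [Module Φ A] where
  grade : ZMod 2 → Submodule Φ A
  isCompl : IsCompl (grade 0) (grade 1)
  mul_mem : ∀ {i j : ZMod 2} {a b : A}, a ∈ grade i → b ∈ grade j → a * b ∈ grade (i + j)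

open Superalgebra

/-- The associator `(a, b, c) = (ab)c - a(bc)`. -/
def assoc {A : Type v} [NonUnitalNonAssocRing A] (a b c : A) : A := a * b * c - a * (b * c)

/-- The commutator `[a, b] = ab - ba`. -/
def comm {A : Type v} [NonUnitalNonAssocRing A] (a b : A) : A := a * b - b * a

/-- The sign `(-1)^{ij}` for parities `i`, `j`. -/
def koszul (Φ : Type u) [Field Φ] (i j : ZMod 2) : Φ := (-1) ^ (i.val * j.val)

section General

variable (Φ : Type u) (A : Type v) [Field Φ] [NonUnitalNonAssocRing A] [Module Φ A]
  [Superalgebra Φ A]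

/-- The projection of `A = A₀ ⊕ A₁` onto the odd component `A₁`. -/
def oddPart : A →ₗ[Φ] A :=
  (grade (Φ := Φ) (A := A) 1).projection (grade 0) isCompl.symm

variable {Φ A}

theorem oddPart_mem (a : A) : oddPart Φ A a ∈ grade (Φ := Φ) (A := A) 1 :=
  Submodule.projection_apply_mem _ _

theorem sub_oddPart_mem (a : A) : a - oddPart Φ A a ∈ grade (Φ := Φ) (A := A) 0 := by
  have h : oddPart Φ A (a - oddPart Φ A a) = 0 := by
    rw [map_sub, sub_eq_zero]
    exact (Submodule.projection_apply_left isCompl.symm ⟨_, oddPart_mem a⟩).symm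
  exact (Submodule.projection_apply_eq_zero_iff _).1 h

theorem oddPart_of_even {a : A} (h : a ∈ grade (Φ := Φ) (A := A) 0) : oddPart Φ A a = 0 :=
  (Submodule.projection_apply_eq_zero_iff _).2 h

theorem oddPart_of_odd {a : A} (h : a ∈ grade (Φ := Φ) (A := A) 1) : oddPart Φ A a = a :=
  Submodule.projection_apply_left isCompl.symm ⟨_, h⟩

end General

/-- An isomorphism of superalgebras: a bijective linear map that preserves the product and
the parity. -/
structure SuperIso (Φ : Type u) (A : Type v) (B : Type w) [Field Φ]
    [NonUnitalNonAssocRing A] [Module Φ A] [Superalgebra Φ A]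
    [NonUnitalNonAssocRing B] [Module Φ B] [Superalgebra Φ B] extends A ≃ₗ[Φ] B where
  map_mul' : ∀ a b : A, toFun (a * b) = toFun a * toFun b
  map_grade' : ∀ (i : ZMod 2) (a : A),
    a ∈ grade (Φ := Φ) (A := A) i ↔ toFun a ∈ grade (Φ := Φ) (A := B) i

/-! ### Graded ideals and quotient superalgebras -/

/-- A graded two-sided ideal (a subspace that is closed under multiplication by arbitrary
elements and under taking homogeneous components). -/
structure SIdeal (Φ : Type u) (A : Type v) [Field Φ] [NonUnitalNonAssocRing A] [Module Φ A]
    [Superalgebra Φ A] extends Submodule Φ A where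
  mul_left' : ∀ (a : A) {b : A}, b ∈ carrier → a * b ∈ carrier
  mul_right' : ∀ (a : A) {b : A}, b ∈ carrier → b * a ∈ carrier
  odd_mem' : ∀ {b : A}, b ∈ carrier → oddPart Φ A b ∈ carrier

namespace SIdeal

variable {Φ : Type u} {A : Type v} [Field Φ] [NonUnitalNonAssocRing A] [Module Φ A]
  [Superalgebra Φ A]

/-- The intersection of a set of graded ideals. -/
def inter (S : Set (SIdeal Φ A)) : SIdeal Φ A where
  carrier := {a | ∀ I ∈ S, a ∈ I.toSubmodule}
  add_mem' ha hb I hI := I.toSubmodule.add_mem (ha I hI) (hb I hI)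
  zero_mem' I _ := I.toSubmodule.zero_mem
  smul_mem' c _ ha I hI := I.toSubmodule.smul_mem c (ha I hI)
  mul_left' a _ hb I hI := I.mul_left' a (hb I hI)
  mul_right' a _ hb I hI := I.mul_right' a (hb I hI)
  odd_mem' hb I hI := I.odd_mem' (hb I hI)

/-- The smallest graded ideal containing `S`. For a set `S` that contains the homogeneous
components of its elements this is the ideal generated by `S`. -/
def generate (S : Set A) : SIdeal Φ A := inter {I | S ⊆ (I.toSubmodule : Set A)}

/-- The quotient superalgebra `A / I`. -/
def Quo (I : SIdeal Φ A) : Type v := A ⧸ I.toSubmodule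

variable (I : SIdeal Φ A)

instance : AddCommGroup I.Quo := inferInstanceAs (AddCommGroup (A ⧸ I.toSubmodule))

instance : Module Φ I.Quo := inferInstanceAs (Module Φ (A ⧸ I.toSubmodule))

/-- The canonical map `A → A / I`. -/
def proj : A →ₗ[Φ] I.Quo := I.toSubmodule.mkQ

theorem proj_surjective : Function.Surjective I.proj := I.toSubmodule.mkQ_surjective

theorem proj_eq_zero {a : A} : I.proj a = 0 ↔ a ∈ I.toSubmodule :=
  Submodule.Quotient.mk_eq_zero _

theorem proj_eq {a b : A} : I.proj a = I.proj b ↔ a - b ∈ I.toSubmodule :=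
  Submodule.Quotient.eq _

instance : Mul I.Quo where
  mul := Quotient.map₂ (· * ·) (by
    intro a a' ha b b' hb
    have ha' : a - a' ∈ I.toSubmodule := (Submodule.quotientRel_def _).1 ha
    have hb' : b - b' ∈ I.toSubmodule := (Submodule.quotientRel_def _).1 hb
    refine (Submodule.quotientRel_def _).2 ?_
    have e : a * b - a' * b' = (a - a') * b + a' * (b - b') := by
      rw [sub_mul, mul_sub]; abel
    rw [e]
    exact I.toSubmodule.add_mem (I.mul_right' b ha') (I.mul_left' a' hb'))

theorem proj_mul (a b : A) : I.proj (a * b) = I.proj a * I.proj b := rfl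

instance : NonUnitalNonAssocRing I.Quo where
  left_distrib := by
    intro a b c
    obtain ⟨a, rfl⟩ := I.proj_surjective a
    obtain ⟨b, rfl⟩ := I.proj_surjective b
    obtain ⟨c, rfl⟩ := I.proj_surjective c
    rw [← map_add, ← proj_mul, mul_add, map_add, proj_mul, proj_mul]
  right_distrib := by
    intro a b c
    obtain ⟨a, rfl⟩ := I.proj_surjective a
    obtain ⟨b, rfl⟩ := I.proj_surjective b
    obtain ⟨c, rfl⟩ := I.proj_surjective c
    rw [← map_add, ← proj_mul, add_mul, map_add, proj_mul, proj_mul]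
  zero_mul := by
    intro a
    obtain ⟨a, rfl⟩ := I.proj_surjective a
    rw [← map_zero I.proj, ← proj_mul, zero_mul]
  mul_zero := by
    intro a
    obtain ⟨a, rfl⟩ := I.proj_surjective a
    rw [← map_zero I.proj, ← proj_mul, mul_zero]

instance [IsScalarTower Φ A A] : IsScalarTower Φ I.Quo I.Quo where
  smul_assoc := by
    intro r a b
    obtain ⟨a, rfl⟩ := I.proj_surjective a
    obtain ⟨b, rfl⟩ := I.proj_surjective b
    simp only [smul_eq_mul]
    rw [← map_smul, ← proj_mul, smul_mul_assoc, map_smul, proj_mul]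

instance [SMulCommClass Φ A A] : SMulCommClass Φ I.Quo I.Quo where
  smul_comm := by
    intro r a b
    obtain ⟨a, rfl⟩ := I.proj_surjective a
    obtain ⟨b, rfl⟩ := I.proj_surjective b
    simp only [smul_eq_mul]
    rw [← map_smul, ← proj_mul, ← proj_mul, mul_smul_comm, map_smul]

instance : Superalgebra Φ I.Quo where
  grade i := (grade (Φ := Φ) (A := A) i).map I.proj
  isCompl := by
    constructor
    · rw [Submodule.disjoint_def]
      rintro _ ⟨a, ha, rfl⟩ ⟨b, hb, hab⟩
      have h := I.odd_mem' (I.proj_eq.1 hab)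
      rw [map_sub, oddPart_of_odd hb, oddPart_of_even ha, sub_zero] at h
      rw [← hab]
      exact I.proj_eq_zero.2 h
    · rw [codisjoint_iff, eq_top_iff]
      intro q _
      obtain ⟨a, rfl⟩ := I.proj_surjective q
      refine Submodule.mem_sup.2 ⟨_, ⟨_, sub_oddPart_mem (Φ := Φ) a, rfl⟩, _,
        ⟨_, oddPart_mem (Φ := Φ) a, rfl⟩, ?_⟩
      rw [← map_add, sub_add_cancel]
  mul_mem := by
    rintro i j _ _ ⟨a, ha, rfl⟩ ⟨b, hb, rfl⟩
    exact ⟨a * b, mul_mem ha hb, rfl⟩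

end SIdeal

/-! ### Grassmann envelopes and superalgebras of a variety -/

/-- The unital Grassmann algebra on the generators `e₀, e₁, e₂, …`. -/
abbrev Grassmann (Φ : Type u) [Field Φ] : Type u := ExteriorAlgebra Φ (ℕ →₀ Φ)

/-- The component of parity `i` of the Grassmann algebra. -/
def grassmannPart (Φ : Type u) [Field Φ] (i : ZMod 2) : Submodule Φ (Grassmann Φ) :=
  CliffordAlgebra.evenOdd (0 : QuadraticForm Φ (ℕ →₀ Φ)) i

section Varieties

variable (Φ : Type u) (A : Type v) [Field Φ] [NonUnitalNonAssocRing A] [Module Φ A]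
  [IsScalarTower Φ A A] [SMulCommClass Φ A A] [Superalgebra Φ A]

/-- The Grassmann envelope `G(A) = A₀ ⊗ G₀ + A₁ ⊗ G₁`, inside the algebra `A ⊗ G` with the
product `(a ⊗ g)(b ⊗ h) = ab ⊗ gh`. -/
def envelope : Submodule Φ (A ⊗[Φ] Grassmann Φ) :=
  ⨆ i : ZMod 2, LinearMap.range
    (TensorProduct.map (grade (Φ := Φ) (A := A) i).subtype (grassmannPart Φ i).subtype)

/-- `A` is a Jordan superalgebra: its Grassmann envelope is commutative and satisfies
`(p², q, p) = 0`. -/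
def IsJordan : Prop :=
  ∀ p ∈ envelope Φ A, ∀ q ∈ envelope Φ A, p * q = q * p ∧ assoc (p * p) q p = 0

/-- `A` is a strongly (-1,1)-superalgebra: its Grassmann envelope satisfies `(p, q, q) = 0`,
`(p, q, r) + (q, r, p) + (r, p, q) = 0` and `[[p, q], r] = 0`. -/
def IsStronglyMinusOneOne : Prop :=
  ∀ p ∈ envelope Φ A, ∀ q ∈ envelope Φ A, ∀ r ∈ envelope Φ A,
    assoc p q q = 0 ∧ assoc p q r + assoc q r p + assoc r p q = 0 ∧ comm (comm p q) r = 0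

end Varieties

/-! ### Free superalgebras -/

section Free

variable (Φ : Type u) [Field Φ]

/-- The parity of a nonassociative word: the number of its odd letters modulo 2. The letters
`Sum.inl _` are even, the letters `Sum.inr _` are odd. -/
def parity {X : Type v} {Y : Type w} : FreeMagma (X ⊕ Y) → ZMod 2
  | .of (.inl _) => 0
  | .of (.inr _) => 1
  | .mul p q => parity p + parity q

/-- The free nonassociative superalgebra on the set `X` of even and the set `Y` of odd
generators. -/
abbrev FreeSuper (X : Type v) (Y : Type w) : Type (max u v w) :=
  FreeNonUnitalNonAssocAlgebra Φ (X ⊕ Y)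

/-- The component of parity `i`: the span of the words of parity `i`. -/
def freeGrade (X : Type v) (Y : Type w) (i : ZMod 2) : Submodule Φ (FreeSuper Φ X Y) :=
  Submodule.span Φ {p | ∃ m : FreeMagma (X ⊕ Y), parity m = i ∧ p = MonoidAlgebra.single m 1}

theorem coeff_of_mem_freeGrade {X : Type v} {Y : Type w} {i : ZMod 2} {p : FreeSuper Φ X Y}
    (hp : p ∈ freeGrade Φ X Y i) (m : FreeMagma (X ⊕ Y)) (hm : parity m ≠ i) :
    p.coeff m = 0 := by
  induction hp using Submodule.span_induction with
  | mem p h =>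
    classical
    obtain ⟨n, hn, rfl⟩ := h
    rw [MonoidAlgebra.coeff_single, Finsupp.single_apply, if_neg]
    rintro rfl
    exact hm hn
  | zero => rfl
  | add p q _ _ hp hq => rw [MonoidAlgebra.coeff_add, Finsupp.add_apply, hp, hq, add_zero]
  | smul c p _ hp => rw [MonoidAlgebra.coeff_smul, Finsupp.smul_apply, hp, smul_zero]

instance (X : Type v) (Y : Type w) : Superalgebra Φ (FreeSuper Φ X Y) where
  grade := freeGrade Φ X Y
  isCompl := by
    constructor
    · rw [Submodule.disjoint_def]
      intro p h0 h1
      ext m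
      by_cases hm : parity m = 0
      · exact coeff_of_mem_freeGrade Φ h1 m (by rw [hm]; decide)
      · exact coeff_of_mem_freeGrade Φ h0 m hm
    · rw [codisjoint_iff, eq_top_iff]
      intro p _
      induction p using MonoidAlgebra.induction_linear with
      | zero => exact Submodule.zero_mem _
      | add p q hp hq => exact Submodule.add_mem _ (hp trivial) (hq trivial)
      | single m r =>
        have e : (MonoidAlgebra.single m r : FreeSuper Φ X Y)
            = r • MonoidAlgebra.single m 1 := by
          rw [MonoidAlgebra.smul_single', mul_one]
        rw [e]
        refine Submodule.smul_mem _ _ ?_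
        have h : ∀ i : ZMod 2, i = 0 ∨ i = 1 := by decide
        rcases h (parity m) with h | h
        · exact Submodule.mem_sup_left (Submodule.subset_span ⟨m, h, rfl⟩)
        · exact Submodule.mem_sup_right (Submodule.subset_span ⟨m, h, rfl⟩)
  mul_mem := by
    intro i j a b ha hb
    induction ha using Submodule.span_induction with
    | zero => rw [zero_mul]; exact Submodule.zero_mem _
    | add p q _ _ hp hq => rw [add_mul]; exact Submodule.add_mem _ hp hq
    | smul c p _ hp => rw [smul_mul_assoc]; exact Submodule.smul_mem _ _ hp
    | mem p h =>
      obtain ⟨m, hm, rfl⟩ := h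
      induction hb using Submodule.span_induction with
      | zero => rw [mul_zero]; exact Submodule.zero_mem _
      | add p q _ _ hp hq => rw [mul_add]; exact Submodule.add_mem _ hp hq
      | smul c p _ hp => rw [mul_smul_comm]; exact Submodule.smul_mem _ _ hp
      | mem q h =>
        obtain ⟨n, hn, rfl⟩ := h
        rw [MonoidAlgebra.single_mul_single, mul_one]
        exact Submodule.subset_span ⟨m * n, by rw [← hm, ← hn]; rfl, rfl⟩

/-- The free Jordan superalgebra on one odd generator and the set `Z` of even generators: the
quotient of the free nonassociative superalgebra by the smallest graded ideal with a Jordan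
quotient. -/
abbrev FreeJordan (Z : Type v) : Type (max u v) :=
  (SIdeal.inter {I : SIdeal Φ (FreeSuper Φ Z Unit) | IsJordan Φ I.Quo}).Quo

/-- The free strongly (-1,1)-superalgebra on one odd generator and the set `Z` of even
generators: the quotient of the free nonassociative superalgebra by the smallest graded ideal
with a strongly (-1,1) quotient. -/
abbrev FreeStrong (Z : Type v) : Type (max u v) :=
  (SIdeal.inter {I : SIdeal Φ (FreeSuper Φ Z Unit) | IsStronglyMinusOneOne Φ I.Quo}).Quo

/-- The generators of the free Jordan superalgebra. -/
def FreeJordan.gen (Z : Type v) (g : Z ⊕ Unit) : FreeJordan Φ Z :=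
  SIdeal.proj _ (FreeNonUnitalNonAssocAlgebra.of Φ g)

/-- The generators of the free strongly (-1,1)-superalgebra. -/
def FreeStrong.gen (Z : Type v) (g : Z ⊕ Unit) : FreeStrong Φ Z :=
  SIdeal.proj _ (FreeNonUnitalNonAssocAlgebra.of Φ g)

/-! ### Central extensions -/

/-- The Jordan central extension `J[Z;x]`: the quotient of the free Jordan superalgebra by the
ideal generated by `(z, a, b) + (-1)^{ab} (z, b, a)` for `z ∈ Z` and homogeneous `a`, `b`. -/
abbrev JordanExt (Z : Type v) : Type (max u v) :=
  (SIdeal.generate (Φ := Φ) {r : FreeJordan Φ Z | ∃ (z : Z) (i j : ZMod 2) (a b : FreeJordan Φ Z),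
    a ∈ grade (Φ := Φ) i ∧ b ∈ grade (Φ := Φ) j ∧
    r = assoc (FreeJordan.gen Φ Z (.inl z)) a b +
      koszul Φ i j • assoc (FreeJordan.gen Φ Z (.inl z)) b a}).Quo

/-- The central extension `F[Z;x]`: the quotient of the free strongly (-1,1)-superalgebra by
the ideal generated by `[z, f]` for `z ∈ Z` and arbitrary `f`. -/
abbrev StrongExt (Z : Type v) : Type (max u v) :=
  (SIdeal.generate (Φ := Φ) {r : FreeStrong Φ Z | ∃ (z : Z) (f : FreeStrong Φ Z),
    r = comm (FreeStrong.gen Φ Z (.inl z)) f}).Quo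

/-- The even generators `z ∈ Z` of `J[Z;x]`. -/
def JordanExt.z {Z : Type v} (z : Z) : JordanExt Φ Z := SIdeal.proj _ (FreeJordan.gen Φ Z (.inl z))

/-- The odd generator `x` of `J[Z;x]`. -/
def JordanExt.x (Z : Type v) : JordanExt Φ Z := SIdeal.proj _ (FreeJordan.gen Φ Z (.inr ()))

/-- The even generators `z ∈ Z` of `F[Z;x]`. -/
def StrongExt.z {Z : Type v} (z : Z) : StrongExt Φ Z := SIdeal.proj _ (FreeStrong.gen Φ Z (.inl z))

/-- The odd generator `x` of `F[Z;x]`. -/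
def StrongExt.x (Z : Type v) : StrongExt Φ Z := SIdeal.proj _ (FreeStrong.gen Φ Z (.inr ()))

end Free

/-! ### The symmetrized superalgebra -/

section Plus

/-- The vector space of the symmetrized superalgebra `A⁽⁺⁾`. -/
def Plus (_Φ : Type u) (A : Type v) : Type v := A

variable (Φ : Type u) (A : Type v) [Field Φ] [NonUnitalNonAssocRing A] [Module Φ A]

instance : AddCommGroup (Plus Φ A) := inferInstanceAs (AddCommGroup A)

instance : Module Φ (Plus Φ A) := inferInstanceAs (Module Φ A)

/-- The identity map `A → A⁽⁺⁾`. -/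
def toPlus : A ≃ₗ[Φ] Plus Φ A := LinearEquiv.refl Φ A

variable [Superalgebra Φ A]

/-- The supersymmetric product, `a • b = ½ (ab + (-1)^{ab} ba)` on homogeneous elements: the
sign differs from `+1` only on the product of the odd components. -/
instance : Mul (Plus Φ A) where
  mul p q :=
    let a : A := (toPlus Φ A).symm p
    let b : A := (toPlus Φ A).symm q
    toPlus Φ A ((2⁻¹ : Φ) • (a * b + b * a - (2 : Φ) • (oddPart Φ A b * oddPart Φ A a)))

variable {Φ A}

theorem toPlus_mul (a b : A) : toPlus Φ A a * toPlus Φ A b =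
    toPlus Φ A ((2⁻¹ : Φ) • (a * b + b * a - (2 : Φ) • (oddPart Φ A b * oddPart Φ A a))) := rfl

theorem toPlus_mul_of_mem {i j : ZMod 2} {a b : A} (ha : a ∈ grade (Φ := Φ) i)
    (hb : b ∈ grade (Φ := Φ) j) : toPlus Φ A a * toPlus Φ A b =
      toPlus Φ A ((2⁻¹ : Φ) • (a * b + koszul Φ i j • (b * a))) := by
  have h : ∀ i : ZMod 2, i = 0 ∨ i = 1 := by decide
  rw [toPlus_mul]
  rcases h i with rfl | rfl <;> rcases h j with rfl | rfl
  · simp [oddPart_of_even ha, koszul]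
  · simp [oddPart_of_even ha, koszul]
  · simp [oddPart_of_even hb, koszul]
  · rw [oddPart_of_odd ha, oddPart_of_odd hb]
    have : koszul Φ 1 1 = -1 := by simp [koszul, ZMod.val_one]
    rw [this, two_smul, neg_one_smul]
    congr 2
    abel

variable (Φ A)

instance : NonUnitalNonAssocRing (Plus Φ A) where
  left_distrib := by
    intro a b c
    obtain ⟨a, rfl⟩ := (toPlus Φ A).surjective a
    obtain ⟨b, rfl⟩ := (toPlus Φ A).surjective b
    obtain ⟨c, rfl⟩ := (toPlus Φ A).surjective c
    rw [← map_add, toPlus_mul, toPlus_mul, toPlus_mul, ← map_add, ← smul_add]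
    congr 2
    simp only [map_add, mul_add, add_mul, smul_add]
    abel
  right_distrib := by
    intro a b c
    obtain ⟨a, rfl⟩ := (toPlus Φ A).surjective a
    obtain ⟨b, rfl⟩ := (toPlus Φ A).surjective b
    obtain ⟨c, rfl⟩ := (toPlus Φ A).surjective c
    rw [← map_add, toPlus_mul, toPlus_mul, toPlus_mul, ← map_add, ← smul_add]
    congr 2
    simp only [map_add, mul_add, add_mul, smul_add]
    abel
  zero_mul := by
    intro a
    obtain ⟨a, rfl⟩ := (toPlus Φ A).surjective a
    rw [← map_zero (toPlus Φ A), toPlus_mul]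
    simp
  mul_zero := by
    intro a
    obtain ⟨a, rfl⟩ := (toPlus Φ A).surjective a
    rw [← map_zero (toPlus Φ A), toPlus_mul]
    simp

instance : Superalgebra Φ (Plus Φ A) where
  grade i := (grade (Φ := Φ) (A := A) i).map (toPlus Φ A : A →ₗ[Φ] Plus Φ A)
  isCompl := isCompl.map (Submodule.orderIsoMapComap (toPlus Φ A))
  mul_mem := by
    rintro i j _ _ ⟨a, ha, rfl⟩ ⟨b, hb, rfl⟩
    refine ⟨_, ?_, (toPlus_mul_of_mem ha hb).symm⟩
    refine Submodule.smul_mem _ _ (Submodule.add_mem _ (mul_mem ha hb)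
      (Submodule.smul_mem _ _ ?_))
    rw [add_comm]
    exact mul_mem hb ha

end Plus

/-! ### Jordan superalgebras of vector type -/

section VectorType

variable {Φ : Type u} {Γ : Type v} [Field Φ] [CommRing Γ] [Algebra Φ Γ]

/-- The vector space `Γ ⊕ Γ̄` of the superalgebra of (even) vector type `J(Γ, D)`, for a
commutative associative algebra `Γ` with a derivation `D`; the pair `(a, b)` is `a + b̄`. -/
def VectorType (_D : Derivation Φ Γ Γ) : Type v := Γ × Γ

variable (D : Derivation Φ Γ Γ)

namespace VectorType

instance : AddCommGroup (VectorType D) := inferInstanceAs (AddCommGroup (Γ × Γ))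

instance : Module Φ (VectorType D) := inferInstanceAs (Module Φ (Γ × Γ))

/-- `a ↦ a`, the embedding of `Γ` as the even component. -/
def ofEven : Γ →ₗ[Φ] VectorType D := LinearMap.inl Φ Γ Γ

/-- `a ↦ ā`, the embedding of `Γ` as the odd component `Γ̄`. -/
def ofOdd : Γ →ₗ[Φ] VectorType D := LinearMap.inr Φ Γ Γ

/-- The product `a • b = ab`, `a • b̄ = ā • b = \overline{ab}`, `ā • b̄ = D(a)b - aD(b)`. -/
instance : Mul (VectorType D) where
  mul p q := (p.1 * q.1 + (D p.2 * q.2 - p.2 * D q.2), p.1 * q.2 + p.2 * q.1)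

theorem ofEven_mul_ofEven (a b : Γ) : ofEven D a * ofEven D b = ofEven D (a * b) :=
  Prod.ext (show a * b + (D 0 * 0 - 0 * D 0) = a * b by simp) (show a * 0 + 0 * b = 0 by simp)

theorem ofEven_mul_ofOdd (a b : Γ) : ofEven D a * ofOdd D b = ofOdd D (a * b) :=
  Prod.ext (show a * 0 + (D 0 * b - 0 * D b) = 0 by simp) (show a * b + 0 * 0 = a * b by simp)

theorem ofOdd_mul_ofEven (a b : Γ) : ofOdd D a * ofEven D b = ofOdd D (a * b) :=
  Prod.ext (show 0 * b + (D a * 0 - a * D 0) = 0 by simp) (show 0 * 0 + a * b = a * b by simp)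

theorem ofOdd_mul_ofOdd (a b : Γ) : ofOdd D a * ofOdd D b = ofEven D (D a * b - a * D b) :=
  Prod.ext (show 0 * 0 + (D a * b - a * D b) = D a * b - a * D b by simp)
    (show 0 * b + a * 0 = 0 by simp)

instance : NonUnitalNonAssocRing (VectorType D) where
  left_distrib p q r := by
    refine Prod.ext ?_ ?_
    · change p.1 * (q.1 + r.1) + (D p.2 * (q.2 + r.2) - p.2 * D (q.2 + r.2)) =
        p.1 * q.1 + (D p.2 * q.2 - p.2 * D q.2) + (p.1 * r.1 + (D p.2 * r.2 - p.2 * D r.2))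
      rw [map_add]; ring
    · change p.1 * (q.2 + r.2) + p.2 * (q.1 + r.1) = p.1 * q.2 + p.2 * q.1 + (p.1 * r.2 + p.2 * r.1)
      ring
  right_distrib p q r := by
    refine Prod.ext ?_ ?_
    · change (p.1 + q.1) * r.1 + (D (p.2 + q.2) * r.2 - (p.2 + q.2) * D r.2) =
        p.1 * r.1 + (D p.2 * r.2 - p.2 * D r.2) + (q.1 * r.1 + (D q.2 * r.2 - q.2 * D r.2))
      rw [map_add]; ring
    · change (p.1 + q.1) * r.2 + (p.2 + q.2) * r.1 = p.1 * r.2 + p.2 * r.1 + (q.1 * r.2 + q.2 * r.1)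
      ring
  zero_mul p := by
    refine Prod.ext ?_ ?_
    · change (0 : Γ) * p.1 + (D 0 * p.2 - 0 * D p.2) = 0
      simp
    · change (0 : Γ) * p.2 + 0 * p.1 = 0
      simp
  mul_zero p := by
    refine Prod.ext ?_ ?_
    · change p.1 * (0 : Γ) + (D p.2 * 0 - p.2 * D 0) = 0
      simp
    · change p.1 * (0 : Γ) + p.2 * 0 = 0
      simp

/-- `J(Γ, D)₀ = Γ` and `J(Γ, D)₁ = Γ̄`. -/
instance : Superalgebra Φ (VectorType D) where
  grade i := if i = 0 then LinearMap.range (ofEven D) else LinearMap.range (ofOdd D)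
  isCompl := by
    rw [if_pos rfl, if_neg one_ne_zero]
    exact LinearMap.isCompl_range_inl_inr
  mul_mem := by
    have h : ∀ i : ZMod 2, i = 0 ∨ i = 1 := by decide
    have h2 : (1 : ZMod 2) + 1 = 0 := by decide
    intro i j a b ha hb
    rcases h i with rfl | rfl <;> rcases h j with rfl | rfl <;>
      simp only [if_true, one_ne_zero, if_false, add_zero, zero_add, h2] at ha hb ⊢ <;>
      obtain ⟨a, rfl⟩ := ha <;> obtain ⟨b, rfl⟩ := hb
    · exact ⟨_, (ofEven_mul_ofEven D a b).symm⟩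
    · exact ⟨_, (ofEven_mul_ofOdd D a b).symm⟩
    · exact ⟨_, (ofOdd_mul_ofEven D a b).symm⟩
    · exact ⟨_, (ofOdd_mul_ofOdd D a b).symm⟩

end VectorType

end VectorType

/-! ### The differential polynomial algebra -/

section Poly

variable (Φ : Type u) [Field Φ] (Z : Type v)

/-- The polynomial algebra `Φ[T_Z]` on the variables `z_i` (written `X (z, i)`), `z ∈ Z`,
`i = 0, 1, 2, …`. -/
abbrev DiffPoly : Type (max u v) := MvPolynomial (Z × ℕ) Φ

/-- The derivation of `Φ[T_Z]` with `D(z_i) = z_{i+1}`. -/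
def shiftD : Derivation Φ (DiffPoly Φ Z) (DiffPoly Φ Z) :=
  MvPolynomial.mkDerivation Φ fun t => MvPolynomial.X (t.1, t.2 + 1)

theorem constantCoeff_shiftD (p : DiffPoly Φ Z) :
    MvPolynomial.constantCoeff (shiftD Φ Z p) = 0 := by
  induction p using MvPolynomial.induction_on with
  | C a => simp [shiftD]
  | add p q hp hq => rw [map_add, map_add, hp, hq, add_zero]
  | mul_X p t _ =>
    rw [Derivation.leibniz]
    simp [shiftD]

/-- The subsuperalgebra `Φ₀[T_Z] ⊕ \overline{Φ[T_Z]}` of `J(Φ[T_Z], D)`, where `Φ₀[T_Z]` consists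
of the polynomials without constant term. -/
def vectorSub : NonUnitalSubalgebra Φ (VectorType (shiftD Φ Z)) where
  carrier := {p | MvPolynomial.constantCoeff p.1 = 0}
  add_mem' := by
    intro p q hp hq
    change MvPolynomial.constantCoeff (p.1 + q.1) = 0
    rw [map_add, hp, hq, add_zero]
  zero_mem' := map_zero _
  mul_mem' := by
    intro p q hp hq
    change MvPolynomial.constantCoeff (p.1 * q.1 + (shiftD Φ Z p.2 * q.2 - p.2 * shiftD Φ Z q.2)) = 0
    have hp' : MvPolynomial.constantCoeff p.1 = 0 := hp
    simp [hp', constantCoeff_shiftD]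
  smul_mem' := by
    intro c p hp
    change MvPolynomial.constantCoeff (c • p.1) = 0
    have hp' : MvPolynomial.constantCoeff p.1 = 0 := hp
    rw [MvPolynomial.smul_eq_C_mul, map_mul, hp', mul_zero]

/-- The induced grading: `Φ₀[T_Z]` is the even and `\overline{Φ[T_Z]}` the odd component. -/
instance : Superalgebra Φ (vectorSub Φ Z) where
  grade i := (grade (Φ := Φ) (A := VectorType (shiftD Φ Z)) i).comap
    (vectorSub Φ Z).toSubmodule.subtype
  isCompl := by
    have hc := isCompl (Φ := Φ) (A := VectorType (shiftD Φ Z))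
    constructor
    · rw [Submodule.disjoint_def]
      intro p h0 h1
      exact Subtype.ext (Submodule.disjoint_def.1 hc.disjoint p.1 h0 h1)
    · rw [codisjoint_iff, eq_top_iff]
      rintro ⟨⟨a, b⟩, h⟩ _
      refine Submodule.mem_sup.2 ⟨⟨(a, 0), h⟩, ⟨a, rfl⟩, ⟨(0, b), map_zero _⟩, ⟨b, rfl⟩, ?_⟩
      exact Subtype.ext (Prod.ext (add_zero a) (zero_add b))
  mul_mem := fun ha hb => mul_mem (A := VectorType (shiftD Φ Z)) ha hb

/-- The element `z_0 ∈ Φ₀[T_Z]`. -/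
def vectorSub.z (z : Z) : vectorSub Φ Z :=
  ⟨VectorType.ofEven _ (MvPolynomial.X (z, 0)), MvPolynomial.constantCoeff_X (R := Φ) (z, 0)⟩

/-- The element `\overline{1}`. -/
def vectorSub.oneBar : vectorSub Φ Z := ⟨VectorType.ofOdd _ 1, map_zero _⟩

end Poly

/-! ### Monomials -/

section Monomials

variable {A : Type v} [NonUnitalNonAssocRing A]

/-- The operator `R_{x,x} = R_x R_x - R_{xx}`, that is `a ↦ (a, x, x)`. -/
def Rxx (x a : A) : A := a * x * x - a * (x * x)

/-- The left-normed product `w(g₁, i₁) w(g₂, i₂) ⋯ w(gₙ, iₙ)`, `n ≥ 1`. -/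
def monomial {ι : Type w} (f : ι × ℕ → A) (g : ι × ℕ) (L : List (ι × ℕ)) : A :=
  L.foldl (fun a h => a * f h) (f g)

end Monomials

end VectorSuper

end

/-! Both central extensions have explicit coordinates in Φ[T] ⊕ Φ[T] with image Φ₀[T] ⊕ Φ[T]; the
isomorphisms are read off by comparing coordinates.

The model for J[Z;x] is J(Φ[T_Z], D). The model for F[Z;x] is `TwistedType` over Φ[T_{Z ∪ {s}}],
with ā b̄ = γab + 4D(a)b + 2aD(b) and γ = s₀. Here R_{x,x} at x = 1̄ acts on even elements as 4D,
and 1̄ 1̄ = γ. This is why ¼R_{x,x} and x² appear in the statement: x² plays the part of the extra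
variable s. Half the supercommutative combination of ā b̄ and b̄ ā is D(a)b − aD(b), so the
symmetrized twisted model is exactly the Jordan model (`TwistedType.symmetrized_mul`).

That the extensions are no larger than the models rests on one good subalgebra of even elements in
each. In the Jordan case it consists of the w with (w, a, b) superskew in a, b; in the strongly
(-1,1) case, of the even elements commuting with everything. Each is closed under products and under
R_{x,x} (`isSkew_mul`, `isSkew_rxx`, `isEvenCentral_mul`, `isEvenCentral_rxx`) and satisfies w(w'c)
= (ww')c. On it a multiple δ of R_{x,x} is a derivation, and kx · lx = γkl + αδ(k)l + βkδ(l), with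
(γ, α, β) = (0, 1, −1) and (x², 4, 2) respectively. Hence, if L is the subalgebra generated by the
elements u_{g,i} (or v_{g,i}), the space L + Lx + Φx is a subalgebra containing the generators, so
it is everything (`exists_eq_add_mul_add_smul`).

That they are no smaller follows from the universal properties: the homomorphism to the model sends
the generators of L to distinct polynomial variables. Since L is commutative and associative,
evaluating polynomials at those generators inverts the homomorphism on L, and injectivity follows
(`bijective_of_map_eq_X`).

Envelope identities are replaced throughout by multilinear superidentities on homogeneous elements;
polarization and its converse use that 2 and 3 are invertible. -/

noncomputable section

namespace VectorSuper

universe u v w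

open Superalgebra

/-! ### Signs and multilinear superidentities -/

section Signs

variable {Φ : Type u} [Field Φ]

@[simp] theorem koszul_zero_left (j : ZMod 2) : koszul Φ 0 j = 1 := by simp [koszul]

@[simp] theorem koszul_zero_right (i : ZMod 2) : koszul Φ i 0 = 1 := by simp [koszul]

@[simp] theorem koszul_one_one : koszul Φ 1 1 = -1 := by simp [koszul, ZMod.val_one]

@[simp] theorem zmod_two_one_add_one : (1 : ZMod 2) + 1 = 0 := by decide

theorem zmod_two_cases (i : ZMod 2) : i = 0 ∨ i = 1 := by revert i; decide

theorem koszul_comm (i j : ZMod 2) : koszul Φ i j = koszul Φ j i := by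
  simp only [koszul, mul_comm]

theorem koszul_mul_self (i j : ZMod 2) : koszul Φ i j * koszul Φ i j = 1 := by
  rcases zmod_two_cases i with rfl | rfl <;> rcases zmod_two_cases j with rfl | rfl <;> simp

end Signs

section Identities

variable (Φ : Type u) {A : Type v} [Field Φ] [NonUnitalNonAssocRing A] [Module Φ A]

/-- The supercommutator of elements of parities `i`, `j`. -/
def superComm (i j : ZMod 2) (a b : A) : A := a * b - koszul Φ i j • (b * a)

/-- The multilinear form of `(p², q, p)` for a supercommutative product, at `a, b, c, d` of
parities `i, j, k, l`, where `d` takes the place of `q`. -/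
def superJordan (i j k l : ZMod 2) (a b c d : A) : A :=
  assoc (a * b) d c +
    (koszul Φ i j * koszul Φ i l * koszul Φ i k * koszul Φ k l) • assoc (b * c) d a +
    (koszul Φ k i * koszul Φ k l * koszul Φ k j * koszul Φ l j) • assoc (c * a) d b

/-- The multilinear form of `(p, q, q)`. -/
def superRightAlt (j k : ZMod 2) (a b c : A) : A := assoc a b c + koszul Φ j k • assoc a c b

/-- The cyclic sum of associators with signs. -/
def superCyclic (i j k : ZMod 2) (a b c : A) : A :=
  assoc a b c + (koszul Φ i j * koszul Φ i k) • assoc b c a +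
    (koszul Φ k i * koszul Φ k j) • assoc c a b

variable {Φ} {B : Type w} [NonUnitalNonAssocRing B] [Module Φ B]

theorem map_superComm (f : A →ₗ[Φ] B) (hf : ∀ a b, f (a * b) = f a * f b) (i j : ZMod 2)
    (a b : A) : f (superComm Φ i j a b) = superComm Φ i j (f a) (f b) := by
  simp only [superComm, map_sub, map_smul, hf]

theorem map_superJordan (f : A →ₗ[Φ] B) (hf : ∀ a b, f (a * b) = f a * f b) (i j k l : ZMod 2)
    (a b c d : A) :
    f (superJordan Φ i j k l a b c d) = superJordan Φ i j k l (f a) (f b) (f c) (f d) := by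
  simp only [superJordan, assoc, map_add, map_sub, map_smul, hf]

theorem map_superRightAlt (f : A →ₗ[Φ] B) (hf : ∀ a b, f (a * b) = f a * f b) (j k : ZMod 2)
    (a b c : A) : f (superRightAlt Φ j k a b c) = superRightAlt Φ j k (f a) (f b) (f c) := by
  simp only [superRightAlt, assoc, map_add, map_sub, map_smul, hf]

theorem map_superCyclic (f : A →ₗ[Φ] B) (hf : ∀ a b, f (a * b) = f a * f b) (i j k : ZMod 2)
    (a b c : A) : f (superCyclic Φ i j k a b c) = superCyclic Φ i j k (f a) (f b) (f c) := by
  simp only [superCyclic, assoc, map_add, map_sub, map_smul, hf]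

end Identities

section Structures

variable (Φ : Type u) (A : Type v) [Field Φ] [NonUnitalNonAssocRing A] [Module Φ A]
  [Superalgebra Φ A]

/-- The multilinear superidentities of Jordan superalgebras. -/
structure SuperJordan : Prop where
  supercomm : ∀ (i j : ZMod 2) (a b : A), a ∈ grade (Φ := Φ) i → b ∈ grade (Φ := Φ) j →
    superComm Φ i j a b = 0
  jordan : ∀ (i j k l : ZMod 2) (a b c d : A), a ∈ grade (Φ := Φ) i → b ∈ grade (Φ := Φ) j →
    c ∈ grade (Φ := Φ) k → d ∈ grade (Φ := Φ) l → superJordan Φ i j k l a b c d = 0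

/-- The multilinear superidentities of strongly (-1,1)-superalgebras. -/
structure SuperStrong : Prop where
  rightAlt : ∀ (i j k : ZMod 2) (a b c : A), a ∈ grade (Φ := Φ) i → b ∈ grade (Φ := Φ) j →
    c ∈ grade (Φ := Φ) k → superRightAlt Φ j k a b c = 0
  cyclic : ∀ (i j k : ZMod 2) (a b c : A), a ∈ grade (Φ := Φ) i → b ∈ grade (Φ := Φ) j →
    c ∈ grade (Φ := Φ) k → superCyclic Φ i j k a b c = 0
  supercomm : ∀ (i j k : ZMod 2) (a b c : A), a ∈ grade (Φ := Φ) i → b ∈ grade (Φ := Φ) j →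
    c ∈ grade (Φ := Φ) k → superComm Φ (i + j) k (superComm Φ i j a b) c = 0

end Structures

/-! ### The Grassmann algebra -/

section Grassmann

variable {Φ : Type u} [Field Φ]

/-- The exterior algebra is the Clifford algebra of the zero form, for which all vectors are
orthogonal; the sign rule for orthogonal pieces of a Clifford algebra then applies to the algebra
and itself. -/
theorem grassmann_mul_comm {i j : ZMod 2} {g h : Grassmann Φ} (hg : g ∈ grassmannPart Φ i)
    (hh : h ∈ grassmannPart Φ j) : g * h = koszul Φ i j • (h * g) := by
  have key := CliffordAlgebra.map_mul_map_of_isOrtho_of_mem_evenOdd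
    (QuadraticMap.Isometry.id (0 : QuadraticForm Φ (ℕ →₀ Φ)))
    (QuadraticMap.Isometry.id (0 : QuadraticForm Φ (ℕ →₀ Φ)))
    (fun x y => by simp [QuadraticMap.IsOrtho]) g h hg hh
  simp only [CliffordAlgebra.map_id, AlgHom.id_apply] at key
  rw [key]
  rcases zmod_two_cases i with rfl | rfl <;> rcases zmod_two_cases j with rfl | rfl <;> simp

/-- The generator `e_n` of the Grassmann algebra if `i` is odd, the unit if `i` is even. -/
def grassmannLetter (Φ : Type u) [Field Φ] (i : ZMod 2) (n : ℕ) : Grassmann Φ :=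
  if i = 0 then 1 else ExteriorAlgebra.ι Φ (Finsupp.single n 1)

theorem grassmannLetter_mem (i : ZMod 2) (n : ℕ) :
    grassmannLetter Φ i n ∈ grassmannPart Φ i := by
  rcases zmod_two_cases i with rfl | rfl
  · simp only [grassmannLetter, if_true]
    exact SetLike.GradedOne.one_mem (A := CliffordAlgebra.evenOdd (0 : QuadraticForm Φ (ℕ →₀ Φ)))
  · simp only [grassmannLetter, one_ne_zero, if_false]
    exact CliffordAlgebra.ι_mem_evenOdd_one _ _

/-- Pairing the product with the matching coordinate functionals gives the determinant of an
identity matrix, because the indices are distinct. -/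
theorem prod_grassmann_ne_zero (l : List ℕ) (hl : l.Nodup) :
    (l.map fun n => (ExteriorAlgebra.ι Φ (Finsupp.single n 1) : Grassmann Φ)).prod ≠ 0 := by
  intro h0
  have h1 : exteriorPower.ιMulti Φ l.length
      (fun i => (Finsupp.single (l.get i) 1 : ℕ →₀ Φ)) = 0 := by
    apply Subtype.ext
    rw [exteriorPower.ιMulti_apply_coe, ExteriorAlgebra.ιMulti_apply]
    rw [ZeroMemClass.coe_zero, ← h0]
    congr 1
    conv_rhs => rw [← List.ofFn_get l, List.map_ofFn]
    rfl
  have h2 := exteriorPower.pairingDual_ιMulti_ιMulti (R := Φ) (M := ℕ →₀ Φ)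
    (fun i => Finsupp.lapply (l.get i)) (fun i => (Finsupp.single (l.get i) 1 : ℕ →₀ Φ))
  rw [h1, map_zero] at h2
  have h3 : (Matrix.of fun i j => (Finsupp.lapply (R := Φ) (l.get j) : (ℕ →₀ Φ) →ₗ[Φ] Φ)
      (Finsupp.single (l.get i) 1)) = 1 := by
    ext i j
    simp [Matrix.one_apply, Finsupp.single_apply, List.Nodup.getElem_inj_iff hl, Fin.ext_iff]
  rw [h3, Matrix.det_one] at h2
  exact zero_ne_one h2

/-- Test elements for extracting superidentities of degree at most four: odd arguments receive
different generators and even ones the unit, so no information is lost in the tensor product. -/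
theorem grassmannLetter_mul_ne_zero (i j k l : ZMod 2) :
    grassmannLetter Φ i 0 * grassmannLetter Φ j 1 * grassmannLetter Φ k 2 *
      grassmannLetter Φ l 3 ≠ 0 := by
  have h := prod_grassmann_ne_zero (Φ := Φ)
  rcases zmod_two_cases i with rfl | rfl <;> rcases zmod_two_cases j with rfl | rfl <;>
    rcases zmod_two_cases k with rfl | rfl <;> rcases zmod_two_cases l with rfl | rfl <;>
    simp only [grassmannLetter, one_ne_zero, if_true, if_false, one_mul, mul_one]
  · simp
  · simp
  · simp
  · simpa using h [2, 3] (by decide)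
  · simp
  · simpa using h [1, 3] (by decide)
  · simpa using h [1, 2] (by decide)
  · simpa [mul_assoc] using h [1, 2, 3] (by decide)
  · simp
  · simpa using h [0, 3] (by decide)
  · simpa using h [0, 2] (by decide)
  · simpa [mul_assoc] using h [0, 2, 3] (by decide)
  · simpa using h [0, 1] (by decide)
  · simpa [mul_assoc] using h [0, 1, 3] (by decide)
  · simpa [mul_assoc] using h [0, 1, 2] (by decide)
  · simpa [mul_assoc] using h [0, 1, 2, 3] (by decide)

theorem grassmann_mul_mem {i j : ZMod 2} {g h : Grassmann Φ} (hg : g ∈ grassmannPart Φ i)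
    (hh : h ∈ grassmannPart Φ j) : g * h ∈ grassmannPart Φ (i + j) :=
  SetLike.GradedMul.mul_mem (A := CliffordAlgebra.evenOdd (0 : QuadraticForm Φ (ℕ →₀ Φ))) hg hh

theorem grassmann_swap {i j : ZMod 2} {g h : Grassmann Φ} (hg : g ∈ grassmannPart Φ i)
    (hh : h ∈ grassmannPart Φ j) (k : Grassmann Φ) :
    g * (h * k) = koszul Φ i j • (h * (g * k)) := by
  rw [← mul_assoc, grassmann_mul_comm hg hh, smul_mul_assoc, mul_assoc]

/-- Over a field some linear functional is nonzero at g; applying it to the second factor leaves a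
nonzero multiple of a. -/
theorem eq_zero_of_tmul_eq_zero {A : Type v} [AddCommGroup A] [Module Φ A] {a : A}
    {g : Grassmann Φ} (hg : g ≠ 0) (h : a ⊗ₜ[Φ] g = 0) : a = 0 := by
  obtain ⟨f, hf⟩ : ∃ f : Module.Dual Φ (Grassmann Φ), f g ≠ 0 := by
    by_contra! hf
    exact hg ((Module.forall_dual_apply_eq_zero_iff Φ g).1 hf)
  have h1 := congrArg (fun t => TensorProduct.rid Φ A (f.lTensor A t)) h
  simp only [LinearMap.lTensor_tmul, TensorProduct.rid_tmul, map_zero] at h1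
  exact (smul_eq_zero.1 h1).resolve_left hf

end Grassmann

/-! ### Superidentities and the Grassmann envelope -/

section Tensor

variable {Φ : Type u} {A : Type v} [Field Φ] [NonUnitalNonAssocRing A] [Module Φ A]

theorem tmul_mem_envelope [Superalgebra Φ A] {i : ZMod 2} {a : A} {g : Grassmann Φ} (ha : a ∈ grade (Φ := Φ) i)
    (hg : g ∈ grassmannPart Φ i) : a ⊗ₜ[Φ] g ∈ envelope Φ A :=
  Submodule.mem_iSup_of_mem i ⟨(⟨a, ha⟩ : grade (Φ := Φ) (A := A) i) ⊗ₜ ⟨g, hg⟩, rfl⟩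

theorem envelope_induction [Superalgebra Φ A]
    {P : ∀ p : A ⊗[Φ] Grassmann Φ, p ∈ envelope Φ A → Prop}
    (zero : P 0 (zero_mem _))
    (add : ∀ p q hp hq, P p hp → P q hq → P (p + q) (add_mem hp hq))
    (tmul : ∀ (i : ZMod 2) (a : A) (g : Grassmann Φ) (ha : a ∈ grade (Φ := Φ) i)
      (hg : g ∈ grassmannPart Φ i), P (a ⊗ₜ g) (tmul_mem_envelope ha hg))
    {p : A ⊗[Φ] Grassmann Φ} (hp : p ∈ envelope Φ A) : P p hp := by
  suffices h : ∃ hp, P p hp from h.2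
  refine Submodule.iSup_induction _ (motive := fun p => ∃ hp, P p hp) hp ?_ ⟨_, zero⟩
    fun p q hp hq => ⟨_, add p q hp.1 hq.1 hp.2 hq.2⟩
  rintro i _ ⟨t, rfl⟩
  induction t with
  | zero => simp only [map_zero]; exact ⟨zero_mem _, zero⟩
  | add s t hs ht => simp only [map_add]; exact ⟨add_mem hs.1 ht.1, add _ _ _ _ hs.2 ht.2⟩
  | tmul a g => exact ⟨_, tmul i a g a.2 g.2⟩

/-- An expression additive in each of three arguments vanishes on the envelope once it vanishes on
homogeneous pure tensors. -/
theorem envelope_induction_three [Superalgebra Φ A]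
    {E : (p q r : A ⊗[Φ] Grassmann Φ) → A ⊗[Φ] Grassmann Φ}
    (h₁ : ∀ q r p p', E (p + p') q r = E p q r + E p' q r) (h₁' : ∀ q r, E 0 q r = 0)
    (h₂ : ∀ p r q q', E p (q + q') r = E p q r + E p q' r) (h₂' : ∀ p r, E p 0 r = 0)
    (h₃ : ∀ p q r r', E p q (r + r') = E p q r + E p q r') (h₃' : ∀ p q, E p q 0 = 0)
    (h : ∀ (i j k : ZMod 2) (a b c : A) (g₁ g₂ g₃ : Grassmann Φ), a ∈ grade (Φ := Φ) i →
      b ∈ grade (Φ := Φ) j → c ∈ grade (Φ := Φ) k → g₁ ∈ grassmannPart Φ i →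
      g₂ ∈ grassmannPart Φ j → g₃ ∈ grassmannPart Φ k → E (a ⊗ₜ g₁) (b ⊗ₜ g₂) (c ⊗ₜ g₃) = 0)
    {p q r : A ⊗[Φ] Grassmann Φ} (hp : p ∈ envelope Φ A) (hq : q ∈ envelope Φ A)
    (hr : r ∈ envelope Φ A) : E p q r = 0 := by
  induction hp using envelope_induction with
  | zero => exact h₁' _ _
  | add p p' _ _ hp hp' => rw [h₁, hp, hp', add_zero]
  | tmul i a g ha hg =>
    induction hq using envelope_induction with
    | zero => exact h₂' _ _
    | add p p' _ _ hp hp' => rw [h₂, hp, hp', add_zero]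
    | tmul j b g' hb hg' =>
      induction hr using envelope_induction with
      | zero => exact h₃' _ _
      | add p p' _ _ hp hp' => rw [h₃, hp, hp', add_zero]
      | tmul k c g'' hc hg'' => exact h i j k a b c g g' g'' ha hb hc hg hg' hg''

variable [IsScalarTower Φ A A] [SMulCommClass Φ A A]

theorem assoc_tmul (a b c : A) (g h k : Grassmann Φ) :
    assoc (a ⊗ₜ[Φ] g) (b ⊗ₜ[Φ] h) (c ⊗ₜ[Φ] k) = assoc a b c ⊗ₜ[Φ] (g * h * k) := by
  simp only [assoc, Algebra.TensorProduct.tmul_mul_tmul, TensorProduct.sub_tmul, mul_assoc]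

theorem comm_tmul {i j : ZMod 2} (a b : A) {g h : Grassmann Φ}
    (hg : g ∈ grassmannPart Φ i) (hh : h ∈ grassmannPart Φ j) :
    comm (a ⊗ₜ[Φ] g) (b ⊗ₜ[Φ] h) = superComm Φ i j a b ⊗ₜ[Φ] (g * h) := by
  have e : h * g = koszul Φ i j • (g * h) := by
    rw [grassmann_mul_comm hg hh, smul_smul, koszul_mul_self, one_smul]
  simp only [comm, superComm, Algebra.TensorProduct.tmul_mul_tmul, TensorProduct.sub_tmul, e,
    TensorProduct.tmul_smul, TensorProduct.smul_tmul']

/-- The signs in `superJordan` are those that bring the Grassmann factors of the three terms to the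
common order g₁g₂g₄g₃, the order in which they occur in the first term. -/
theorem jordan_tmul {i j k l : ZMod 2} (a b c d : A) {g₁ g₂ g₃ g₄ : Grassmann Φ}
    (h₁ : g₁ ∈ grassmannPart Φ i) (h₂ : g₂ ∈ grassmannPart Φ j) (h₃ : g₃ ∈ grassmannPart Φ k)
    (h₄ : g₄ ∈ grassmannPart Φ l) :
    assoc (a ⊗ₜ[Φ] g₁ * b ⊗ₜ[Φ] g₂) (d ⊗ₜ[Φ] g₄) (c ⊗ₜ[Φ] g₃) +
      assoc (b ⊗ₜ[Φ] g₂ * c ⊗ₜ[Φ] g₃) (d ⊗ₜ[Φ] g₄) (a ⊗ₜ[Φ] g₁) +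
      assoc (c ⊗ₜ[Φ] g₃ * a ⊗ₜ[Φ] g₁) (d ⊗ₜ[Φ] g₄) (b ⊗ₜ[Φ] g₂) =
      superJordan Φ i j k l a b c d ⊗ₜ[Φ] (g₁ * g₂ * g₄ * g₃) := by
  have e1 : g₂ * g₃ * g₄ * g₁ = (koszul Φ i j * koszul Φ i l * koszul Φ i k * koszul Φ k l) •
      (g₁ * g₂ * g₄ * g₃) := by
    simp only [mul_assoc]
    rw [grassmann_mul_comm h₄ h₁, mul_smul_comm, mul_smul_comm, grassmann_swap h₃ h₁,
      mul_smul_comm, grassmann_swap h₂ h₁, grassmann_mul_comm h₃ h₄]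
    simp only [mul_smul_comm, smul_smul]
    rw [koszul_comm l i, koszul_comm j i, koszul_comm k i]
    ring_nf
  have e2 : g₃ * g₁ * g₄ * g₂ = (koszul Φ k i * koszul Φ k l * koszul Φ k j * koszul Φ l j) •
      (g₁ * g₂ * g₄ * g₃) := by
    simp only [mul_assoc]
    rw [grassmann_mul_comm h₄ h₂, grassmann_swap h₃ h₁]
    simp only [mul_smul_comm]
    rw [grassmann_swap h₃ h₂, grassmann_mul_comm h₃ h₄]
    simp only [mul_smul_comm, smul_smul]
    ring_nf
  simp only [assoc_tmul, Algebra.TensorProduct.tmul_mul_tmul, superJordan, TensorProduct.add_tmul,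
    e1, e2, TensorProduct.tmul_smul, TensorProduct.smul_tmul']

theorem rightAlt_tmul {j k : ZMod 2} (a b c : A) {g₁ g₂ g₃ : Grassmann Φ}
    (h₂ : g₂ ∈ grassmannPart Φ j) (h₃ : g₃ ∈ grassmannPart Φ k) :
    assoc (a ⊗ₜ[Φ] g₁) (b ⊗ₜ[Φ] g₂) (c ⊗ₜ[Φ] g₃) + assoc (a ⊗ₜ[Φ] g₁) (c ⊗ₜ[Φ] g₃) (b ⊗ₜ[Φ] g₂) =
      superRightAlt Φ j k a b c ⊗ₜ[Φ] (g₁ * g₂ * g₃) := by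
  have e : g₁ * g₃ * g₂ = koszul Φ j k • (g₁ * g₂ * g₃) := by
    rw [mul_assoc, grassmann_mul_comm h₃ h₂, mul_smul_comm, mul_assoc, koszul_comm]
  simp only [assoc_tmul, superRightAlt, TensorProduct.add_tmul, e, TensorProduct.tmul_smul,
    TensorProduct.smul_tmul']

theorem cyclic_tmul {i j k : ZMod 2} (a b c : A) {g₁ g₂ g₃ : Grassmann Φ}
    (h₁ : g₁ ∈ grassmannPart Φ i) (h₂ : g₂ ∈ grassmannPart Φ j) (h₃ : g₃ ∈ grassmannPart Φ k) :
    assoc (a ⊗ₜ[Φ] g₁) (b ⊗ₜ[Φ] g₂) (c ⊗ₜ[Φ] g₃) + assoc (b ⊗ₜ[Φ] g₂) (c ⊗ₜ[Φ] g₃) (a ⊗ₜ[Φ] g₁) +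
      assoc (c ⊗ₜ[Φ] g₃) (a ⊗ₜ[Φ] g₁) (b ⊗ₜ[Φ] g₂) =
      superCyclic Φ i j k a b c ⊗ₜ[Φ] (g₁ * g₂ * g₃) := by
  have e1 : g₂ * g₃ * g₁ = (koszul Φ i j * koszul Φ i k) • (g₁ * g₂ * g₃) := by
    simp only [mul_assoc]
    rw [grassmann_mul_comm h₃ h₁, mul_smul_comm, grassmann_swap h₂ h₁, smul_smul,
      koszul_comm k i, koszul_comm j i, mul_comm]
  have e2 : g₃ * g₁ * g₂ = (koszul Φ k i * koszul Φ k j) • (g₁ * g₂ * g₃) := by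
    simp only [mul_assoc]
    rw [grassmann_swap h₃ h₁, grassmann_mul_comm h₃ h₂, mul_smul_comm, smul_smul]
  simp only [assoc_tmul, superCyclic, TensorProduct.add_tmul, e1, e2, TensorProduct.tmul_smul,
    TensorProduct.smul_tmul']

end Tensor

/-! ### Equivalence of envelope identities and multilinear superidentities -/

section Envelope

variable {Φ : Type u} {A : Type v} [Field Φ] [NonUnitalNonAssocRing A] [Module Φ A]
  [IsScalarTower Φ A A] [SMulCommClass Φ A A] [Superalgebra Φ A]

theorem SuperJordan.of_isJordan (h2 : (2 : Φ) ≠ 0) (h : IsJordan Φ A) : SuperJordan Φ A where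
  supercomm i j a b ha hb := by
    have h1 := (h _ (tmul_mem_envelope ha (grassmannLetter_mem i 0)) _
      (tmul_mem_envelope hb (grassmannLetter_mem j 1))).1
    have e := comm_tmul a b (grassmannLetter_mem (Φ := Φ) i 0) (grassmannLetter_mem j 1)
    rw [VectorSuper.comm, h1, sub_self] at e
    refine eq_zero_of_tmul_eq_zero ?_ e.symm
    simpa [grassmannLetter] using grassmannLetter_mul_ne_zero (Φ := Φ) i j 0 0
  jordan i j k l a b c d ha hb hc hd := by
    -- The argument c receives letter 3 and d letter 2, so that the common factor g₁g₂g₄g₃ has its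
    -- letters in increasing order.
    have e := jordan_tmul a b c d (grassmannLetter_mem (Φ := Φ) i 0) (grassmannLetter_mem j 1)
      (grassmannLetter_mem k 3) (grassmannLetter_mem l 2)
    refine eq_zero_of_tmul_eq_zero (grassmannLetter_mul_ne_zero i j l k) (e.symm.trans ?_)
    have hp := tmul_mem_envelope ha (grassmannLetter_mem (Φ := Φ) i 0)
    have hq := tmul_mem_envelope hb (grassmannLetter_mem (Φ := Φ) j 1)
    have hr := tmul_mem_envelope hc (grassmannLetter_mem (Φ := Φ) k 3)
    have hs := tmul_mem_envelope hd (grassmannLetter_mem (Φ := Φ) l 2)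
    clear e
    generalize a ⊗ₜ[Φ] grassmannLetter Φ i 0 = p at *
    generalize b ⊗ₜ[Φ] grassmannLetter Φ j 1 = q at *
    generalize c ⊗ₜ[Φ] grassmannLetter Φ k 3 = r at *
    generalize d ⊗ₜ[Φ] grassmannLetter Φ l 2 = s at *
    have c1 : q * p = p * q := (h q hq p hp).1
    have c2 : r * p = p * r := (h r hr p hp).1
    have c3 : r * q = q * r := (h r hr q hq).1
    have t1 := (h p hp s hs).2
    have t2 := (h q hq s hs).2
    have t3 := (h r hr s hs).2
    have t4 := (h _ (add_mem hp hq) s hs).2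
    have t5 := (h _ (add_mem hp hr) s hs).2
    have t6 := (h _ (add_mem hq hr) s hs).2
    have t7 := (h _ (add_mem (add_mem hp hq) hr) s hs).2
    -- Full polarization of (p², s, p) in p by inclusion and exclusion. Commutativity makes each
    -- term occur twice, hence the factor 2.
    have key : (2 : Φ) • (assoc (p * q) s r + assoc (q * r) s p + assoc (r * p) s q) = 0 := by
      simp only [assoc, mul_add, add_mul, c1, c2, c3] at t1 t2 t3 t4 t5 t6 t7 ⊢
      linear_combination (norm := module) t7 - t6 - t5 - t4 + t1 + t2 + t3
    exact (smul_eq_zero.1 key).resolve_left h2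

theorem SuperJordan.isJordan (h3 : (3 : Φ) ≠ 0) (h : SuperJordan Φ A) :
    IsJordan Φ A := by
  have hc : ∀ p ∈ envelope Φ A, ∀ q ∈ envelope Φ A, p * q = q * p := by
    intro p hp q hq
    induction hp using envelope_induction with
    | zero => simp
    | add p p' _ _ hp hp' => rw [add_mul, mul_add, hp, hp']
    | tmul i a g ha hg =>
      induction hq using envelope_induction with
      | zero => simp
      | add p p' _ _ hp hp' => rw [add_mul, mul_add, hp, hp']
      | tmul j b k hb hk =>
        rw [← sub_eq_zero]
        exact (comm_tmul a b hg hk).trans (by rw [h.supercomm i j a b ha hb, TensorProduct.zero_tmul])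
  have hj : ∀ p ∈ envelope Φ A, ∀ q ∈ envelope Φ A, ∀ r ∈ envelope Φ A, ∀ s ∈ envelope Φ A,
      assoc (p * q) s r + assoc (q * r) s p + assoc (r * p) s q = 0 := by
    intro p hp q hq r hr s hs
    induction hp using envelope_induction with
    | zero => simp [assoc]
    | add p p' _ _ hp hp' =>
      simp only [assoc, mul_add, add_mul] at hp hp' ⊢
      linear_combination (norm := module) hp + hp'
    | tmul i a g ha hg =>
      induction hq using envelope_induction with
      | zero => simp [assoc]
      | add p p' _ _ hp hp' =>
        simp only [assoc, mul_add, add_mul] at hp hp' ⊢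
        linear_combination (norm := module) hp + hp'
      | tmul j b g' hb hg' =>
        induction hr using envelope_induction with
        | zero => simp [assoc]
        | add p p' _ _ hp hp' =>
          simp only [assoc, mul_add, add_mul] at hp hp' ⊢
          linear_combination (norm := module) hp + hp'
        | tmul k c g'' hc hg'' =>
          induction hs using envelope_induction with
          | zero => simp [assoc]
          | add p p' _ _ hp hp' =>
            simp only [assoc, mul_add, add_mul] at hp hp' ⊢
            linear_combination (norm := module) hp + hp'
          | tmul l d g''' hd hg''' =>
            rw [jordan_tmul a b c d hg hg' hg'' hg''', h.jordan i j k l a b c d ha hb hc hd,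
              TensorProduct.zero_tmul]
  intro p hp q hq
  refine ⟨hc p hp q hq, ?_⟩
  -- With all three polarized arguments equal to p, the cyclic sum is three times (p², q, p).
  have key : (3 : Φ) • assoc (p * p) q p = 0 := by
    linear_combination (norm := module) hj p hp p hp p hp q hq
  exact (smul_eq_zero.1 key).resolve_left h3

theorem SuperStrong.of_isStrong (h : IsStronglyMinusOneOne Φ A) : SuperStrong Φ A := by
  have ne : ∀ i j k, grassmannLetter Φ i 0 * grassmannLetter Φ j 1 * grassmannLetter Φ k 2 ≠ 0 :=
    fun i j k => by simpa [grassmannLetter] using grassmannLetter_mul_ne_zero (Φ := Φ) i j k 0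
  constructor <;> intro i j k a b c ha hb hc <;>
    have hp := tmul_mem_envelope ha (grassmannLetter_mem (Φ := Φ) i 0) <;>
    have hq := tmul_mem_envelope hb (grassmannLetter_mem (Φ := Φ) j 1) <;>
    have hr := tmul_mem_envelope hc (grassmannLetter_mem (Φ := Φ) k 2) <;>
    refine eq_zero_of_tmul_eq_zero (ne i j k) ?_
  · rw [← rightAlt_tmul a b c (grassmannLetter_mem j 1) (grassmannLetter_mem k 2)]
    have t1 := (h _ hp _ hq _ hq).1
    have t2 := (h _ hp _ hr _ hr).1
    have t3 := (h _ hp _ (add_mem hq hr) _ hr).1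
    simp only [assoc, mul_add, add_mul] at t1 t2 t3 ⊢
    linear_combination (norm := module) t3 - t1 - t2
  · rw [← cyclic_tmul a b c (grassmannLetter_mem i 0) (grassmannLetter_mem j 1)
      (grassmannLetter_mem k 2)]
    exact (h _ hp _ hq _ hr).2.1
  · have t := (h _ hp _ hq _ hr).2.2
    rwa [comm_tmul a b (grassmannLetter_mem i 0) (grassmannLetter_mem j 1),
      comm_tmul _ c (grassmann_mul_mem (grassmannLetter_mem i 0) (grassmannLetter_mem j 1))
        (grassmannLetter_mem k 2)] at t

theorem SuperStrong.isStrong (h2 : (2 : Φ) ≠ 0) (h : SuperStrong Φ A) :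
    IsStronglyMinusOneOne Φ A := by
  intro p hp q hq r hr
  refine ⟨?_, ?_, ?_⟩
  -- Only the polarized form (p, q, r) + (p, r, q) is additive in every argument; r = q gives twice
  -- the required associator.
  · have key : assoc p q q + assoc p q q = 0 := by
      refine envelope_induction_three (E := fun p q r => assoc p q r + assoc p r q)
        ?_ ?_ ?_ ?_ ?_ ?_ ?_ hp hq hq
      · intros; simp only [assoc, add_mul]; abel
      · intros; simp [assoc]
      · intros; simp only [assoc, mul_add, add_mul]; abel
      · intros; simp [assoc]
      · intros; simp only [assoc, mul_add, add_mul]; abel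
      · intros; simp [assoc]
      · intro i j k a b c g₁ g₂ g₃ ha hb hc h₁ h₂ h₃
        rw [rightAlt_tmul a b c h₂ h₃, h.rightAlt i j k a b c ha hb hc, TensorProduct.zero_tmul]
    rw [← two_smul Φ] at key
    exact (smul_eq_zero.1 key).resolve_left h2
  · refine envelope_induction_three (E := fun p q r => assoc p q r + assoc q r p + assoc r p q)
        ?_ ?_ ?_ ?_ ?_ ?_ ?_ hp hq hr
    · intros; simp only [assoc, mul_add, add_mul]; abel
    · intros; simp [assoc]
    · intros; simp only [assoc, mul_add, add_mul]; abel
    · intros; simp [assoc]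
    · intros; simp only [assoc, mul_add, add_mul]; abel
    · intros; simp [assoc]
    · intro i j k a b c g₁ g₂ g₃ ha hb hc h₁ h₂ h₃
      rw [cyclic_tmul a b c h₁ h₂ h₃, h.cyclic i j k a b c ha hb hc, TensorProduct.zero_tmul]
  · refine envelope_induction_three (E := fun p q r => comm (comm p q) r)
        ?_ ?_ ?_ ?_ ?_ ?_ ?_ hp hq hr
    · intros; simp only [comm, mul_add, add_mul, mul_sub, sub_mul]; abel
    · intros; simp [comm]
    · intros; simp only [comm, mul_add, add_mul, mul_sub, sub_mul]; abel
    · intros; simp [comm]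
    · intros; simp only [comm, mul_add, add_mul]; abel
    · intros; simp [comm]
    · intro i j k a b c g₁ g₂ g₃ ha hb hc h₁ h₂ h₃
      rw [comm_tmul a b h₁ h₂, comm_tmul _ c (grassmann_mul_mem h₁ h₂) h₃,
        h.supercomm i j k a b c ha hb hc, TensorProduct.zero_tmul]

end Envelope

end VectorSuper

namespace VectorSuper

universe u v w

open Superalgebra

/-! ### Universal properties -/

section Lift

variable {Φ : Type u} {A : Type v} {B : Type w} [Field Φ] [NonUnitalNonAssocRing A] [Module Φ A]
  [Superalgebra Φ A] [NonUnitalNonAssocRing B] [Module Φ B] [Superalgebra Φ B]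

/-- A homomorphism of superalgebras. -/
structure IsSuperHom (f : A →ₗ[Φ] B) : Prop where
  map_mul : ∀ a b, f (a * b) = f a * f b
  map_grade : ∀ (i : ZMod 2) (a : A), a ∈ grade (Φ := Φ) i → f a ∈ grade (Φ := Φ) i

namespace IsSuperHom

variable {f : A →ₗ[Φ] B} (hf : IsSuperHom f)
include hf

theorem map_oddPart (a : A) : f (oddPart Φ A a) = oddPart Φ B (f a) := by
  have h1 := oddPart_of_odd (hf.map_grade 1 _ (oddPart_mem (Φ := Φ) a))
  have h0 := oddPart_of_even (hf.map_grade 0 _ (sub_oddPart_mem (Φ := Φ) a))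
  rw [map_sub, map_sub, sub_eq_zero] at h0
  rw [h0, h1]

/-- A homomorphism commutes with the projection to the odd component, so an injective one also
reflects parity. -/
theorem mem_grade_iff (hinj : Function.Injective f) (i : ZMod 2) (a : A) :
    a ∈ grade (Φ := Φ) i ↔ f a ∈ grade (Φ := Φ) i := by
  refine ⟨hf.map_grade i a, fun h => ?_⟩
  rcases zmod_two_cases i with rfl | rfl
  · have e : oddPart Φ A a = 0 := hinj (by rw [hf.map_oddPart, oddPart_of_even h, map_zero])
    simpa [e] using sub_oddPart_mem (Φ := Φ) a
  · have e : oddPart Φ A a = a := hinj (by rw [hf.map_oddPart, oddPart_of_odd h])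
    rw [← e]
    exact oddPart_mem a

/-- The kernel of a homomorphism of superalgebras. -/
def ker : SIdeal Φ A where
  toSubmodule := LinearMap.ker f
  mul_left' a b hb := by
    have hb' : f b = 0 := hb
    change f (a * b) = 0
    rw [hf.map_mul, hb', mul_zero]
  mul_right' a b hb := by
    have hb' : f b = 0 := hb
    change f (b * a) = 0
    rw [hf.map_mul, hb', zero_mul]
  odd_mem' {b} hb := by
    have hb' : f b = 0 := hb
    change f (oddPart Φ A b) = 0
    rw [hf.map_oddPart, hb', map_zero]

end IsSuperHom

namespace SIdeal

variable (I : SIdeal Φ A)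

theorem exists_lift {f : A →ₗ[Φ] B} (hf : IsSuperHom f) (h : ∀ a ∈ I.toSubmodule, f a = 0) :
    ∃ g : I.Quo →ₗ[Φ] B, IsSuperHom g ∧ ∀ a, g (I.proj a) = f a := by
  refine ⟨I.toSubmodule.liftQ f h, ⟨fun p q => ?_, ?_⟩, fun a => rfl⟩
  · obtain ⟨a, rfl⟩ := I.proj_surjective p
    obtain ⟨b, rfl⟩ := I.proj_surjective q
    exact hf.map_mul a b
  · rintro i _ ⟨a, ha, rfl⟩
    exact hf.map_grade i a ha

theorem inter_le {S : Set (SIdeal Φ A)} {I : SIdeal Φ A} (hI : I ∈ S) {a : A}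
    (ha : a ∈ (inter S).toSubmodule) : a ∈ I.toSubmodule := ha I hI

theorem mem_inter {S : Set (SIdeal Φ A)} {a : A} (ha : ∀ I ∈ S, a ∈ I.toSubmodule) :
    a ∈ (inter S).toSubmodule := ha

theorem subset_generate {S : Set A} {a : A} (ha : a ∈ S) :
    a ∈ (generate (Φ := Φ) S).toSubmodule := mem_inter fun _ hI => hI ha

/-- In this form the identities are membership conditions on I, which pass to intersections of
ideals. This makes the free superalgebra itself satisfy them. -/
theorem superJordan_quo_iff : SuperJordan Φ I.Quo ↔
    (∀ (i j : ZMod 2) (a b : A), a ∈ grade (Φ := Φ) i → b ∈ grade (Φ := Φ) j →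
      superComm Φ i j a b ∈ I.toSubmodule) ∧
    (∀ (i j k l : ZMod 2) (a b c d : A), a ∈ grade (Φ := Φ) i → b ∈ grade (Φ := Φ) j →
      c ∈ grade (Φ := Φ) k → d ∈ grade (Φ := Φ) l →
      superJordan Φ i j k l a b c d ∈ I.toSubmodule) := by
  constructor
  · intro h
    constructor
    · intro i j a b ha hb
      rw [← I.proj_eq_zero, map_superComm _ I.proj_mul]
      exact h.supercomm i j _ _ ⟨a, ha, rfl⟩ ⟨b, hb, rfl⟩
    · intro i j k l a b c d ha hb hc hd
      rw [← I.proj_eq_zero, map_superJordan _ I.proj_mul]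
      exact h.jordan i j k l _ _ _ _ ⟨a, ha, rfl⟩ ⟨b, hb, rfl⟩ ⟨c, hc, rfl⟩ ⟨d, hd, rfl⟩
  · rintro ⟨h1, h2⟩
    constructor
    · rintro i j _ _ ⟨a, ha, rfl⟩ ⟨b, hb, rfl⟩
      rw [← map_superComm _ I.proj_mul, I.proj_eq_zero]
      exact h1 i j a b ha hb
    · rintro i j k l _ _ _ _ ⟨a, ha, rfl⟩ ⟨b, hb, rfl⟩ ⟨c, hc, rfl⟩ ⟨d, hd, rfl⟩
      rw [← map_superJordan _ I.proj_mul, I.proj_eq_zero]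
      exact h2 i j k l a b c d ha hb hc hd

theorem superStrong_quo_iff : SuperStrong Φ I.Quo ↔
    ∀ (i j k : ZMod 2) (a b c : A), a ∈ grade (Φ := Φ) i → b ∈ grade (Φ := Φ) j →
      c ∈ grade (Φ := Φ) k → superRightAlt Φ j k a b c ∈ I.toSubmodule ∧
        superCyclic Φ i j k a b c ∈ I.toSubmodule ∧
        superComm Φ (i + j) k (superComm Φ i j a b) c ∈ I.toSubmodule := by
  constructor
  · intro h i j k a b c ha hb hc
    have ha' : I.proj a ∈ grade (Φ := Φ) (A := I.Quo) i := ⟨a, ha, rfl⟩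
    have hb' : I.proj b ∈ grade (Φ := Φ) (A := I.Quo) j := ⟨b, hb, rfl⟩
    have hc' : I.proj c ∈ grade (Φ := Φ) (A := I.Quo) k := ⟨c, hc, rfl⟩
    simp only [← I.proj_eq_zero, map_superRightAlt _ I.proj_mul, map_superCyclic _ I.proj_mul,
      map_superComm _ I.proj_mul]
    exact ⟨h.rightAlt i j k _ _ _ ha' hb' hc', h.cyclic i j k _ _ _ ha' hb' hc',
      h.supercomm i j k _ _ _ ha' hb' hc'⟩
  · intro h
    constructor <;> rintro i j k _ _ _ ⟨a, ha, rfl⟩ ⟨b, hb, rfl⟩ ⟨c, hc, rfl⟩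
    · rw [← map_superRightAlt _ I.proj_mul, I.proj_eq_zero]
      exact (h i j k a b c ha hb hc).1
    · rw [← map_superCyclic _ I.proj_mul, I.proj_eq_zero]
      exact (h i j k a b c ha hb hc).2.1
    · rw [← map_superComm _ I.proj_mul, ← map_superComm _ I.proj_mul, I.proj_eq_zero]
      exact (h i j k a b c ha hb hc).2.2

end SIdeal

theorem SuperJordan.quo (h : SuperJordan Φ A) (I : SIdeal Φ A) : SuperJordan Φ I.Quo :=
  I.superJordan_quo_iff.2
    ⟨fun i j a b ha hb => by rw [h.supercomm i j a b ha hb]; exact zero_mem _,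
      fun i j k l a b c d ha hb hc hd => by
        rw [h.jordan i j k l a b c d ha hb hc hd]; exact zero_mem _⟩

theorem SuperStrong.quo (h : SuperStrong Φ A) (I : SIdeal Φ A) : SuperStrong Φ I.Quo :=
  I.superStrong_quo_iff.2 fun i j k a b c ha hb hc => by
    rw [h.rightAlt i j k a b c ha hb hc, h.cyclic i j k a b c ha hb hc,
      h.supercomm i j k a b c ha hb hc]
    exact ⟨zero_mem _, zero_mem _, zero_mem _⟩

/-- The values of the identities on A are mapped to values on B, which vanish. The kernel is
therefore among the ideals intersected in the free Jordan superalgebra once the envelope identities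
are recovered. -/
theorem SuperJordan.quo_ker (h : SuperJordan Φ B) {f : A →ₗ[Φ] B} (hf : IsSuperHom f) :
    SuperJordan Φ hf.ker.Quo := by
  refine hf.ker.superJordan_quo_iff.2 ⟨fun i j a b ha hb => ?_, fun i j k l a b c d ha hb hc hd => ?_⟩
  · exact (map_superComm f hf.map_mul i j a b).trans
      (h.supercomm i j _ _ (hf.map_grade _ _ ha) (hf.map_grade _ _ hb))
  · exact (map_superJordan f hf.map_mul i j k l a b c d).trans
      (h.jordan i j k l _ _ _ _ (hf.map_grade _ _ ha) (hf.map_grade _ _ hb)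
        (hf.map_grade _ _ hc) (hf.map_grade _ _ hd))

theorem SuperStrong.quo_ker (h : SuperStrong Φ B) {f : A →ₗ[Φ] B} (hf : IsSuperHom f) :
    SuperStrong Φ hf.ker.Quo := by
  refine hf.ker.superStrong_quo_iff.2 fun i j k a b c ha hb hc => ⟨?_, ?_, ?_⟩
  · exact (map_superRightAlt f hf.map_mul j k a b c).trans
      (h.rightAlt i j k _ _ _ (hf.map_grade _ _ ha) (hf.map_grade _ _ hb) (hf.map_grade _ _ hc))
  · exact (map_superCyclic f hf.map_mul i j k a b c).trans
      (h.cyclic i j k _ _ _ (hf.map_grade _ _ ha) (hf.map_grade _ _ hb) (hf.map_grade _ _ hc))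
  · refine (map_superComm f hf.map_mul (i + j) k _ c).trans ?_
    rw [map_superComm f hf.map_mul]
    exact h.supercomm i j k _ _ _ (hf.map_grade _ _ ha) (hf.map_grade _ _ hb)
      (hf.map_grade _ _ hc)

end Lift

/-! ### Free superalgebras and central extensions: generation and universal properties -/

section FreeObjects

variable {Φ : Type u} [Field Φ]

theorem free_induction {X : Type v} {P : FreeNonUnitalNonAssocAlgebra Φ X → Prop}
    (of : ∀ g, P (FreeNonUnitalNonAssocAlgebra.of Φ g))
    (add : ∀ p q, P p → P q → P (p + q)) (smul : ∀ (c : Φ) p, P p → P (c • p))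
    (mul : ∀ p q, P p → P q → P (p * q)) (zero : P 0) (p : FreeNonUnitalNonAssocAlgebra Φ X) :
    P p := by
  have word : ∀ m : FreeMagma X, P (MonoidAlgebra.single m 1) := by
    intro m
    induction m with
    | ih1 g => exact of g
    | ih2 m n hm hn =>
      have e := mul _ _ hm hn
      rwa [MonoidAlgebra.single_mul_single, mul_one] at e
  induction p using MonoidAlgebra.induction_linear with
  | zero => exact zero
  | add p q hp hq => exact add p q hp hq
  | single m r =>
    have e := smul r _ (word m)
    rwa [MonoidAlgebra.smul_single', mul_one] at e

theorem of_mem_freeGrade_zero {X : Type v} {Y : Type w} (g : X) :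
    FreeNonUnitalNonAssocAlgebra.of Φ (Sum.inl g : X ⊕ Y) ∈
      grade (Φ := Φ) (A := FreeSuper Φ X Y) 0 :=
  Submodule.subset_span ⟨.of (.inl g), rfl, rfl⟩

theorem of_mem_freeGrade_one {X : Type v} {Y : Type w} (g : Y) :
    FreeNonUnitalNonAssocAlgebra.of Φ (Sum.inr g : X ⊕ Y) ∈
      grade (Φ := Φ) (A := FreeSuper Φ X Y) 1 :=
  Submodule.subset_span ⟨.of (.inr g), rfl, rfl⟩

theorem exists_free_lift {X : Type v} {Y : Type w} {B : Type*} [NonUnitalNonAssocRing B]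
    [Module Φ B] [IsScalarTower Φ B B] [SMulCommClass Φ B B] [Superalgebra Φ B]
    (f : X → B) (g : Y → B) (hf : ∀ a, f a ∈ grade (Φ := Φ) 0)
    (hg : ∀ a, g a ∈ grade (Φ := Φ) 1) :
    ∃ F : FreeSuper Φ X Y →ₗ[Φ] B, IsSuperHom F ∧
      (∀ a, F (FreeNonUnitalNonAssocAlgebra.of Φ (Sum.inl a)) = f a) ∧
      ∀ a, F (FreeNonUnitalNonAssocAlgebra.of Φ (Sum.inr a)) = g a := by
  let L := FreeNonUnitalNonAssocAlgebra.lift Φ (Sum.elim f g)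
  have word : ∀ m : FreeMagma (X ⊕ Y), L (MonoidAlgebra.single m 1) ∈
      grade (Φ := Φ) (A := B) (parity m) := by
    intro m
    induction m with
    | ih1 a =>
      have e := FreeNonUnitalNonAssocAlgebra.lift_of_apply Φ (Sum.elim f g) a
      rcases a with a | a
      · exact e ▸ hf a
      · exact e ▸ hg a
    | ih2 m n hm hn =>
      have e := mul_mem hm hn
      rwa [← map_mul, MonoidAlgebra.single_mul_single, mul_one] at e
  refine ⟨(L : FreeSuper Φ X Y →ₗ[Φ] B), ⟨fun a b => map_mul L a b, fun i a ha => ?_⟩, fun a => ?_,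
    fun a => ?_⟩
  · change a ∈ ((grade (Φ := Φ) (A := B) i).comap (L : FreeSuper Φ X Y →ₗ[Φ] B))
    have hle : freeGrade Φ X Y i ≤ (grade (Φ := Φ) (A := B) i).comap
        (L : FreeSuper Φ X Y →ₗ[Φ] B) := by
      refine Submodule.span_le.2 ?_
      rintro _ ⟨m, hm, rfl⟩
      rw [← hm]
      exact word m
    exact hle ha
  · exact FreeNonUnitalNonAssocAlgebra.lift_of_apply Φ (Sum.elim f g) (Sum.inl a)
  · exact FreeNonUnitalNonAssocAlgebra.lift_of_apply Φ (Sum.elim f g) (Sum.inr a)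

variable {Z : Type v}

/-- Every ideal in the intersection contains all values of the multilinear superidentities, hence so
does the intersection. -/
theorem superJordan_freeJordan (h2 : (2 : Φ) ≠ 0) : SuperJordan Φ (FreeJordan Φ Z) := by
  refine (SIdeal.superJordan_quo_iff _).2 ⟨fun i j a b ha hb => SIdeal.mem_inter fun I hI => ?_,
    fun i j k l a b c d ha hb hc hd => SIdeal.mem_inter fun I hI => ?_⟩
  · exact (I.superJordan_quo_iff.1 (.of_isJordan h2 hI)).1 i j a b ha hb
  · exact (I.superJordan_quo_iff.1 (.of_isJordan h2 hI)).2 i j k l a b c d ha hb hc hd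

theorem superStrong_freeStrong : SuperStrong Φ (FreeStrong Φ Z) := by
  refine (SIdeal.superStrong_quo_iff _).2 fun i j k a b c ha hb hc =>
    ⟨SIdeal.mem_inter fun I hI => ?_, SIdeal.mem_inter fun I hI => ?_,
      SIdeal.mem_inter fun I hI => ?_⟩
  · exact (I.superStrong_quo_iff.1 (.of_isStrong hI) i j k a b c ha hb hc).1
  · exact (I.superStrong_quo_iff.1 (.of_isStrong hI) i j k a b c ha hb hc).2.1
  · exact (I.superStrong_quo_iff.1 (.of_isStrong hI) i j k a b c ha hb hc).2.2

theorem superJordan_jordanExt (h2 : (2 : Φ) ≠ 0) : SuperJordan Φ (JordanExt Φ Z) :=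
  (superJordan_freeJordan h2).quo _

theorem superStrong_strongExt : SuperStrong Φ (StrongExt Φ Z) := superStrong_freeStrong.quo _

theorem jordanExt_z_mem (z : Z) : JordanExt.z Φ z ∈ grade (Φ := Φ) (A := JordanExt Φ Z) 0 :=
  ⟨_, ⟨_, of_mem_freeGrade_zero z, rfl⟩, rfl⟩

theorem jordanExt_x_mem : JordanExt.x Φ Z ∈ grade (Φ := Φ) (A := JordanExt Φ Z) 1 :=
  ⟨_, ⟨_, of_mem_freeGrade_one (), rfl⟩, rfl⟩

theorem strongExt_z_mem (z : Z) : StrongExt.z Φ z ∈ grade (Φ := Φ) (A := StrongExt Φ Z) 0 :=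
  ⟨_, ⟨_, of_mem_freeGrade_zero z, rfl⟩, rfl⟩

theorem strongExt_x_mem : StrongExt.x Φ Z ∈ grade (Φ := Φ) (A := StrongExt Φ Z) 1 :=
  ⟨_, ⟨_, of_mem_freeGrade_one (), rfl⟩, rfl⟩

theorem jordanExt_relation (z : Z) {i j : ZMod 2} {a b : JordanExt Φ Z}
    (ha : a ∈ grade (Φ := Φ) i) (hb : b ∈ grade (Φ := Φ) j) :
    assoc (JordanExt.z Φ z) a b + koszul Φ i j • assoc (JordanExt.z Φ z) b a = 0 := by
  obtain ⟨a, ha, rfl⟩ := ha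
  obtain ⟨b, hb, rfl⟩ := hb
  exact (SIdeal.proj_eq_zero _).2 (SIdeal.subset_generate ⟨z, i, j, a, b, ha, hb, rfl⟩)

theorem strongExt_relation (z : Z) (f : StrongExt Φ Z) :
    StrongExt.z Φ z * f = f * StrongExt.z Φ z := by
  obtain ⟨f, rfl⟩ := SIdeal.proj_surjective _ f
  exact (SIdeal.proj_eq _).2 (SIdeal.subset_generate ⟨z, f, rfl⟩)

theorem jordanExt_induction {P : JordanExt Φ Z → Prop} (z : ∀ g, P (JordanExt.z Φ g))
    (x : P (JordanExt.x Φ Z)) (add : ∀ p q, P p → P q → P (p + q))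
    (smul : ∀ (c : Φ) p, P p → P (c • p)) (mul : ∀ p q, P p → P q → P (p * q)) (zero : P 0)
    (p : JordanExt Φ Z) : P p := by
  obtain ⟨p, rfl⟩ := SIdeal.proj_surjective _ p
  obtain ⟨p, rfl⟩ := SIdeal.proj_surjective _ p
  induction p using free_induction with
  | of g =>
    rcases g with g | g
    · exact z g
    · exact x
  | add p q hp hq => simp only [map_add]; exact add _ _ hp hq
  | smul c p hp => simp only [map_smul]; exact smul c _ hp
  | mul p q hp hq => simp only [SIdeal.proj_mul]; exact mul _ _ hp hq
  | zero => simp only [map_zero]; exact zero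

theorem strongExt_induction {P : StrongExt Φ Z → Prop} (z : ∀ g, P (StrongExt.z Φ g))
    (x : P (StrongExt.x Φ Z)) (add : ∀ p q, P p → P q → P (p + q))
    (smul : ∀ (c : Φ) p, P p → P (c • p)) (mul : ∀ p q, P p → P q → P (p * q)) (zero : P 0)
    (p : StrongExt Φ Z) : P p := by
  obtain ⟨p, rfl⟩ := SIdeal.proj_surjective _ p
  obtain ⟨p, rfl⟩ := SIdeal.proj_surjective _ p
  induction p using free_induction with
  | of g =>
    rcases g with g | g
    · exact z g
    · exact x
  | add p q hp hq => simp only [map_add]; exact add _ _ hp hq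
  | smul c p hp => simp only [map_smul]; exact smul c _ hp
  | mul p q hp hq => simp only [SIdeal.proj_mul]; exact mul _ _ hp hq
  | zero => simp only [map_zero]; exact zero

/-- The universal property of J[Z;x]. It is enough that the skew relation holds for the images f z
against arbitrary homogeneous elements of B. -/
theorem exists_jordanExt_lift (h3 : (3 : Φ) ≠ 0) {B : Type*}
    [NonUnitalNonAssocRing B] [Module Φ B] [IsScalarTower Φ B B] [SMulCommClass Φ B B]
    [Superalgebra Φ B] (hB : SuperJordan Φ B) (f : Z → B) (y : B)
    (hf : ∀ a, f a ∈ grade (Φ := Φ) 0) (hy : y ∈ grade (Φ := Φ) (A := B) 1)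
    (hrel : ∀ (z : Z) (i j : ZMod 2) (a b : B), a ∈ grade (Φ := Φ) i → b ∈ grade (Φ := Φ) j →
      assoc (f z) a b + koszul Φ i j • assoc (f z) b a = 0) :
    ∃ F : JordanExt Φ Z →ₗ[Φ] B, IsSuperHom F ∧ (∀ z, F (JordanExt.z Φ z) = f z) ∧
      F (JordanExt.x Φ Z) = y := by
  obtain ⟨F, hF, hFf, hFy⟩ := exists_free_lift f (fun _ : Unit => y) hf fun _ => hy
  obtain ⟨G, hG, hGF⟩ := SIdeal.exists_lift
    (SIdeal.inter {I : SIdeal Φ (FreeSuper Φ Z Unit) | IsJordan Φ I.Quo}) hF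
    -- The kernel of F has a Jordan quotient, so it contains the intersection defining the free
    -- Jordan superalgebra.
    fun a ha => SIdeal.inter_le (I := hF.ker) ((hB.quo_ker hF).isJordan h3) ha
  have hz : ∀ z, G (FreeJordan.gen Φ Z (.inl z)) = f z := fun z => (hGF _).trans (hFf z)
  obtain ⟨H, hH, hHG⟩ := SIdeal.exists_lift
    (SIdeal.generate (Φ := Φ) {r : FreeJordan Φ Z | ∃ (z : Z) (i j : ZMod 2)
      (a b : FreeJordan Φ Z), a ∈ grade (Φ := Φ) i ∧ b ∈ grade (Φ := Φ) j ∧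
      r = assoc (FreeJordan.gen Φ Z (.inl z)) a b +
        koszul Φ i j • assoc (FreeJordan.gen Φ Z (.inl z)) b a}) hG
    fun a ha => SIdeal.inter_le (I := hG.ker) (by
      rintro _ ⟨z, i, j, a, b, ha, hb, rfl⟩
      change G _ = 0
      have e := hrel z i j _ _ (hG.map_grade i a ha) (hG.map_grade j b hb)
      simp only [assoc, map_add, map_sub, map_smul, hG.map_mul, hz] at e ⊢
      exact e) ha
  exact ⟨H, hH, fun z => (hHG _).trans (hz z), (hHG _).trans ((hGF _).trans (hFy ()))⟩

theorem exists_strongExt_lift (h2 : (2 : Φ) ≠ 0) {B : Type*}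
    [NonUnitalNonAssocRing B] [Module Φ B] [IsScalarTower Φ B B] [SMulCommClass Φ B B]
    [Superalgebra Φ B] (hB : SuperStrong Φ B) (f : Z → B) (y : B)
    (hf : ∀ a, f a ∈ grade (Φ := Φ) 0) (hy : y ∈ grade (Φ := Φ) (A := B) 1)
    (hrel : ∀ (z : Z) (a : B), f z * a = a * f z) :
    ∃ F : StrongExt Φ Z →ₗ[Φ] B, IsSuperHom F ∧ (∀ z, F (StrongExt.z Φ z) = f z) ∧
      F (StrongExt.x Φ Z) = y := by
  obtain ⟨F, hF, hFf, hFy⟩ := exists_free_lift f (fun _ : Unit => y) hf fun _ => hy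
  obtain ⟨G, hG, hGF⟩ := SIdeal.exists_lift
    (SIdeal.inter {I : SIdeal Φ (FreeSuper Φ Z Unit) | IsStronglyMinusOneOne Φ I.Quo}) hF
    fun a ha => SIdeal.inter_le (I := hF.ker) ((hB.quo_ker hF).isStrong h2) ha
  have hz : ∀ z, G (FreeStrong.gen Φ Z (.inl z)) = f z := fun z => (hGF _).trans (hFf z)
  obtain ⟨H, hH, hHG⟩ := SIdeal.exists_lift
    (SIdeal.generate (Φ := Φ) {r : FreeStrong Φ Z | ∃ (z : Z) (f : FreeStrong Φ Z),
      r = comm (FreeStrong.gen Φ Z (.inl z)) f}) hG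
    fun a ha => SIdeal.inter_le (I := hG.ker) (by
      rintro _ ⟨z, a, rfl⟩
      change G _ = 0
      simp only [comm, map_sub, hG.map_mul, hz, hrel, sub_self]) ha
  exact ⟨H, hH, fun z => (hHG _).trans (hz z), (hHG _).trans ((hGF _).trans (hFy ()))⟩

end FreeObjects

end VectorSuper

namespace VectorSuper

universe u v w

open Superalgebra

/-! ### Superalgebras of vector type are Jordan -/

namespace VectorType

variable {Φ : Type u} {Γ : Type v} [Field Φ] [CommRing Γ] [Algebra Φ Γ] (D : Derivation Φ Γ Γ)

theorem mul_def (p q : VectorType D) :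
    p * q = (p.1 * q.1 + (D p.2 * q.2 - p.2 * D q.2), p.1 * q.2 + p.2 * q.1) := rfl

instance : IsScalarTower Φ (VectorType D) (VectorType D) where
  smul_assoc c p q := by
    refine Prod.ext ?_ ?_
    · change c • p.1 * q.1 + (D (c • p.2) * q.2 - c • p.2 * D q.2) =
        c • (p.1 * q.1 + (D p.2 * q.2 - p.2 * D q.2))
      simp only [Derivation.map_smul, smul_mul_assoc, smul_add, smul_sub]
    · change c • p.1 * q.2 + c • p.2 * q.1 = c • (p.1 * q.2 + p.2 * q.1)
      simp only [smul_mul_assoc, smul_add]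

instance : SMulCommClass Φ (VectorType D) (VectorType D) where
  smul_comm c p q := by
    refine Prod.ext ?_ ?_
    · change c • (p.1 * q.1 + (D p.2 * q.2 - p.2 * D q.2)) =
        p.1 * c • q.1 + (D p.2 * c • q.2 - p.2 * D (c • q.2))
      simp only [Derivation.map_smul, mul_smul_comm, smul_add, smul_sub]
    · change c • (p.1 * q.2 + p.2 * q.1) = p.1 * c • q.2 + p.2 * c • q.1
      simp only [mul_smul_comm, smul_add]

theorem exists_ofEven {a : VectorType D} (ha : a ∈ grade (Φ := Φ) 0) : ∃ b, ofEven D b = a := ha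

theorem exists_ofOdd {a : VectorType D} (ha : a ∈ grade (Φ := Φ) 1) : ∃ b, ofOdd D b = a := ha

theorem ofEven_mem (a : Γ) : ofEven D a ∈ grade (Φ := Φ) (A := VectorType D) 0 := ⟨a, rfl⟩

theorem ofOdd_mem (a : Γ) : ofOdd D a ∈ grade (Φ := Φ) (A := VectorType D) 1 := ⟨a, rfl⟩

theorem ofEven_eq_zero {a : Γ} (h : a = 0) : ofEven D a = 0 := by rw [h, map_zero]

theorem ofOdd_eq_zero {a : Γ} (h : a = 0) : ofOdd D a = 0 := by rw [h, map_zero]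

/-- For each choice of parities the identity becomes a polynomial identity in Γ that follows from
commutativity and the Leibniz rule. -/
theorem superJordan : SuperJordan Φ (VectorType D) where
  supercomm i j a b ha hb := by
    rcases zmod_two_cases i with rfl | rfl <;> rcases zmod_two_cases j with rfl | rfl <;>
      first
        | obtain ⟨a, rfl⟩ := exists_ofEven D ha
        | obtain ⟨a, rfl⟩ := exists_ofOdd D ha
    all_goals
      first
        | obtain ⟨b, rfl⟩ := exists_ofEven D hb
        | obtain ⟨b, rfl⟩ := exists_ofOdd D hb
    all_goals
      simp only [superComm, koszul_zero_left, koszul_zero_right, koszul_one_one, one_smul,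
        neg_smul, ofEven_mul_ofEven, ofEven_mul_ofOdd, ofOdd_mul_ofEven, ofOdd_mul_ofOdd,
        ← map_neg, ← map_sub]
      first
        | apply ofEven_eq_zero
        | apply ofOdd_eq_zero
      ring
  jordan i j k l a b c d ha hb hc hd := by
    rcases zmod_two_cases i with rfl | rfl <;> rcases zmod_two_cases j with rfl | rfl <;>
      rcases zmod_two_cases k with rfl | rfl <;> rcases zmod_two_cases l with rfl | rfl <;>
      first
        | obtain ⟨a, rfl⟩ := exists_ofEven D ha
        | obtain ⟨a, rfl⟩ := exists_ofOdd D ha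
    all_goals
      first
        | obtain ⟨b, rfl⟩ := exists_ofEven D hb
        | obtain ⟨b, rfl⟩ := exists_ofOdd D hb
    all_goals
      first
        | obtain ⟨c, rfl⟩ := exists_ofEven D hc
        | obtain ⟨c, rfl⟩ := exists_ofOdd D hc
    all_goals
      first
        | obtain ⟨d, rfl⟩ := exists_ofEven D hd
        | obtain ⟨d, rfl⟩ := exists_ofOdd D hd
    all_goals
      simp only [VectorSuper.superJordan, assoc, koszul_zero_left, koszul_zero_right,
        koszul_one_one, one_smul, mul_one, mul_neg, neg_neg,
        neg_smul, ofEven_mul_ofEven, ofEven_mul_ofOdd, ofOdd_mul_ofEven, ofOdd_mul_ofOdd,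
        ← map_neg, ← map_sub, ← map_add]
      first
        | apply ofEven_eq_zero
        | apply ofOdd_eq_zero
      try simp only [map_sub, Derivation.leibniz, smul_eq_mul]
      ring

/-- The associator (c, ā, b̄) equals D(c)ab, which is symmetric in a and b, while (c, a, b) vanishes
as soon as a or b is even. -/
theorem assoc_ofEven_skew (c : Γ) {i j : ZMod 2} {a b : VectorType D}
    (ha : a ∈ grade (Φ := Φ) i) (hb : b ∈ grade (Φ := Φ) j) :
    assoc (ofEven D c) a b + koszul Φ i j • assoc (ofEven D c) b a = 0 := by
  rcases zmod_two_cases i with rfl | rfl <;> rcases zmod_two_cases j with rfl | rfl <;>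
    first
      | obtain ⟨a, rfl⟩ := exists_ofEven D ha
      | obtain ⟨a, rfl⟩ := exists_ofOdd D ha
  all_goals
    first
      | obtain ⟨b, rfl⟩ := exists_ofEven D hb
      | obtain ⟨b, rfl⟩ := exists_ofOdd D hb
  all_goals
    simp only [assoc, koszul_zero_left, koszul_zero_right, koszul_one_one, one_smul,
      neg_smul, ofEven_mul_ofEven, ofEven_mul_ofOdd, ofOdd_mul_ofEven, ofOdd_mul_ofOdd,
      ← map_neg, ← map_sub, ← map_add]
    first
      | apply ofEven_eq_zero
      | apply ofOdd_eq_zero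
    try simp only [Derivation.leibniz, smul_eq_mul]
    ring

end VectorType

/-! ### Strongly (-1,1)-superalgebras of vector type -/

section Twisted

variable {Φ : Type u} {Γ : Type v} [Field Φ] [CommRing Γ] [Algebra Φ Γ]

/-- The vector space `Γ ⊕ Γ̄` of the strongly (-1,1)-superalgebra of vector type attached to a
commutative associative algebra `Γ`, a derivation `D` and `γ ∈ Γ`. -/
def TwistedType (_D : Derivation Φ Γ Γ) (_γ : Γ) : Type v := Γ × Γ

variable (D : Derivation Φ Γ Γ) (γ : Γ)

namespace TwistedType

instance : AddCommGroup (TwistedType D γ) := inferInstanceAs (AddCommGroup (Γ × Γ))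

instance : Module Φ (TwistedType D γ) := inferInstanceAs (Module Φ (Γ × Γ))

/-- `a ↦ a`, the embedding of `Γ` as the even component. -/
def ofEven : Γ →ₗ[Φ] TwistedType D γ := LinearMap.inl Φ Γ Γ

/-- `a ↦ ā`, the embedding of `Γ` as the odd component. -/
def ofOdd : Γ →ₗ[Φ] TwistedType D γ := LinearMap.inr Φ Γ Γ

/-- The product `a b = ab`, `a b̄ = ā b = \overline{ab}`, `ā b̄ = γab + 4D(a)b + 2aD(b)`. -/
instance : Mul (TwistedType D γ) where
  mul p q := (p.1 * q.1 + (γ * p.2 * q.2 + 4 * D p.2 * q.2 + 2 * p.2 * D q.2),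
    p.1 * q.2 + p.2 * q.1)

theorem mul_def (p q : TwistedType D γ) :
    p * q = (p.1 * q.1 + (γ * p.2 * q.2 + 4 * D p.2 * q.2 + 2 * p.2 * D q.2),
      p.1 * q.2 + p.2 * q.1) := rfl

theorem ofEven_mul_ofEven (a b : Γ) : ofEven D γ a * ofEven D γ b = ofEven D γ (a * b) :=
  Prod.ext (show a * b + (γ * 0 * 0 + 4 * D 0 * 0 + 2 * 0 * D 0) = a * b by simp)
    (show a * 0 + 0 * b = 0 by simp)

theorem ofEven_mul_ofOdd (a b : Γ) : ofEven D γ a * ofOdd D γ b = ofOdd D γ (a * b) :=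
  Prod.ext (show a * 0 + (γ * 0 * b + 4 * D 0 * b + 2 * 0 * D b) = 0 by simp)
    (show a * b + 0 * 0 = a * b by simp)

theorem ofOdd_mul_ofEven (a b : Γ) : ofOdd D γ a * ofEven D γ b = ofOdd D γ (a * b) :=
  Prod.ext (show 0 * b + (γ * a * 0 + 4 * D a * 0 + 2 * a * D 0) = 0 by simp)
    (show 0 * 0 + a * b = a * b by simp)

theorem ofOdd_mul_ofOdd (a b : Γ) :
    ofOdd D γ a * ofOdd D γ b = ofEven D γ (γ * a * b + 4 * D a * b + 2 * a * D b) :=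
  Prod.ext (show 0 * 0 + (γ * a * b + 4 * D a * b + 2 * a * D b) = _ by rw [mul_zero, zero_add]; rfl)
    (show 0 * b + a * 0 = 0 by simp)

instance : NonUnitalNonAssocRing (TwistedType D γ) where
  left_distrib p q r := by
    refine Prod.ext ?_ ?_
    · change p.1 * (q.1 + r.1) + (γ * p.2 * (q.2 + r.2) + 4 * D p.2 * (q.2 + r.2) +
        2 * p.2 * D (q.2 + r.2)) = p.1 * q.1 + (γ * p.2 * q.2 + 4 * D p.2 * q.2 + 2 * p.2 * D q.2) +
          (p.1 * r.1 + (γ * p.2 * r.2 + 4 * D p.2 * r.2 + 2 * p.2 * D r.2))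
      rw [map_add]; ring
    · change p.1 * (q.2 + r.2) + p.2 * (q.1 + r.1) = p.1 * q.2 + p.2 * q.1 + (p.1 * r.2 + p.2 * r.1)
      ring
  right_distrib p q r := by
    refine Prod.ext ?_ ?_
    · change (p.1 + q.1) * r.1 + (γ * (p.2 + q.2) * r.2 + 4 * D (p.2 + q.2) * r.2 +
        2 * (p.2 + q.2) * D r.2) = p.1 * r.1 + (γ * p.2 * r.2 + 4 * D p.2 * r.2 + 2 * p.2 * D r.2) +
          (q.1 * r.1 + (γ * q.2 * r.2 + 4 * D q.2 * r.2 + 2 * q.2 * D r.2))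
      rw [map_add]; ring
    · change (p.1 + q.1) * r.2 + (p.2 + q.2) * r.1 = p.1 * r.2 + p.2 * r.1 + (q.1 * r.2 + q.2 * r.1)
      ring
  zero_mul p := by
    refine Prod.ext ?_ ?_
    · change (0 : Γ) * p.1 + (γ * 0 * p.2 + 4 * D 0 * p.2 + 2 * 0 * D p.2) = 0
      simp
    · change (0 : Γ) * p.2 + 0 * p.1 = 0
      simp
  mul_zero p := by
    refine Prod.ext ?_ ?_
    · change p.1 * (0 : Γ) + (γ * p.2 * 0 + 4 * D p.2 * 0 + 2 * p.2 * D 0) = 0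
      simp
    · change p.1 * (0 : Γ) + p.2 * 0 = 0
      simp

instance : IsScalarTower Φ (TwistedType D γ) (TwistedType D γ) where
  smul_assoc c p q := by
    refine Prod.ext ?_ ?_
    · change c • p.1 * q.1 + (γ * c • p.2 * q.2 + 4 * D (c • p.2) * q.2 + 2 * c • p.2 * D q.2) =
        c • (p.1 * q.1 + (γ * p.2 * q.2 + 4 * D p.2 * q.2 + 2 * p.2 * D q.2))
      simp only [Derivation.map_smul, smul_mul_assoc, mul_smul_comm, smul_add]
    · change c • p.1 * q.2 + c • p.2 * q.1 = c • (p.1 * q.2 + p.2 * q.1)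
      simp only [smul_mul_assoc, smul_add]

instance : SMulCommClass Φ (TwistedType D γ) (TwistedType D γ) where
  smul_comm c p q := by
    refine Prod.ext ?_ ?_
    · change c • (p.1 * q.1 + (γ * p.2 * q.2 + 4 * D p.2 * q.2 + 2 * p.2 * D q.2)) =
        p.1 * c • q.1 + (γ * p.2 * c • q.2 + 4 * D p.2 * c • q.2 + 2 * p.2 * D (c • q.2))
      simp only [Derivation.map_smul, mul_smul_comm, smul_add]
    · change c • (p.1 * q.2 + p.2 * q.1) = p.1 * c • q.2 + p.2 * c • q.1
      simp only [mul_smul_comm, smul_add]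

instance : Superalgebra Φ (TwistedType D γ) where
  grade i := if i = 0 then LinearMap.range (ofEven D γ) else LinearMap.range (ofOdd D γ)
  isCompl := by
    rw [if_pos rfl, if_neg one_ne_zero]
    exact LinearMap.isCompl_range_inl_inr
  mul_mem := by
    intro i j a b ha hb
    rcases zmod_two_cases i with rfl | rfl <;> rcases zmod_two_cases j with rfl | rfl <;>
      simp only [if_true, one_ne_zero, if_false, add_zero, zero_add, zmod_two_one_add_one]
        at ha hb ⊢ <;>
      obtain ⟨a, rfl⟩ := ha <;> obtain ⟨b, rfl⟩ := hb
    · exact ⟨_, (ofEven_mul_ofEven D γ a b).symm⟩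
    · exact ⟨_, (ofEven_mul_ofOdd D γ a b).symm⟩
    · exact ⟨_, (ofOdd_mul_ofEven D γ a b).symm⟩
    · exact ⟨_, (ofOdd_mul_ofOdd D γ a b).symm⟩

theorem exists_ofEven {a : TwistedType D γ} (ha : a ∈ grade (Φ := Φ) 0) :
    ∃ b, ofEven D γ b = a := ha

theorem exists_ofOdd {a : TwistedType D γ} (ha : a ∈ grade (Φ := Φ) 1) :
    ∃ b, ofOdd D γ b = a := ha

theorem ofEven_mem (a : Γ) : ofEven D γ a ∈ grade (Φ := Φ) (A := TwistedType D γ) 0 := ⟨a, rfl⟩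

theorem ofOdd_mem (a : Γ) : ofOdd D γ a ∈ grade (Φ := Φ) (A := TwistedType D γ) 1 := ⟨a, rfl⟩

theorem ofEven_eq_zero {a : Γ} (h : a = 0) : ofEven D γ a = 0 := by rw [h, map_zero]

theorem ofOdd_eq_zero {a : Γ} (h : a = 0) : ofOdd D γ a = 0 := by rw [h, map_zero]

/-- The coefficients 4 and 2 are dictated by kx · lx = x²kl + R(k)l + ½kR(l) for central k, l, where
R = R_{x,x} and D = ¼R. The identities hold for every γ and D, again by the Leibniz rule in each
choice of parities. -/
theorem superStrong : SuperStrong Φ (TwistedType D γ) := by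
  constructor <;> intro i j k a b c ha hb hc <;>
    rcases zmod_two_cases i with rfl | rfl <;> rcases zmod_two_cases j with rfl | rfl <;>
      rcases zmod_two_cases k with rfl | rfl <;>
    first
      | obtain ⟨a, rfl⟩ := exists_ofEven D γ ha
      | obtain ⟨a, rfl⟩ := exists_ofOdd D γ ha
  all_goals
    first
      | obtain ⟨b, rfl⟩ := exists_ofEven D γ hb
      | obtain ⟨b, rfl⟩ := exists_ofOdd D γ hb
  all_goals
    first
      | obtain ⟨c, rfl⟩ := exists_ofEven D γ hc
      | obtain ⟨c, rfl⟩ := exists_ofOdd D γ hc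
  all_goals
    simp only [superRightAlt, superCyclic, superComm, assoc, koszul_zero_left, koszul_zero_right,
      koszul_one_one, one_smul, mul_one, mul_neg, neg_neg, neg_smul, add_zero, zero_add,
      zmod_two_one_add_one, ofEven_mul_ofEven, ofEven_mul_ofOdd, ofOdd_mul_ofEven,
      ofOdd_mul_ofOdd, ← map_neg, ← map_sub, ← map_add]
    first
      | apply ofEven_eq_zero
      | apply ofOdd_eq_zero
    try simp only [map_sub, Derivation.leibniz, smul_eq_mul]
    ring

theorem ofEven_mul_comm (c : Γ) (a : TwistedType D γ) : ofEven D γ c * a = a * ofEven D γ c := by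
  refine Prod.ext ?_ ?_
  · change c * a.1 + (γ * 0 * a.2 + 4 * D 0 * a.2 + 2 * 0 * D a.2) =
      a.1 * c + (γ * a.2 * 0 + 4 * D a.2 * 0 + 2 * a.2 * D 0)
    simp [mul_comm]
  · change c * a.2 + 0 * a.1 = a.1 * 0 + a.2 * c
    simp [mul_comm]

end TwistedType

end Twisted

end VectorSuper

namespace VectorSuper

universe u v w

/-! ### Algebras generated by a polynomial-like subalgebra and one element -/

section Generated

variable {Φ : Type u} {A : Type v} [Field Φ] [NonUnitalNonAssocRing A] [Module Φ A]
  [IsScalarTower Φ A A] [SMulCommClass Φ A A]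

/-- The closure argument common to both varieties. The multiplication rules are known on a large
subalgebra K of good even elements, while the decomposition is needed over the subalgebra L ⊆ K
generated by the u t. A need not have a unit, so Φx is kept apart from Lx. -/
theorem exists_eq_add_mul_add_smul {Z : Type w} {K : NonUnitalSubalgebra Φ A} {x γ : A} {α β : Φ}
    {u : Z × ℕ → A} (hu : ∀ t, u t ∈ K) {δ : A →ₗ[Φ] A}
    (hδ : ∀ k ∈ K, ∀ l ∈ K, δ (k * l) = k * δ l + l * δ k)
    (hδu : ∀ z i, δ (u (z, i)) = u (z, i + 1))
    (hγ : γ ∈ NonUnitalAlgebra.adjoin Φ (Set.range u))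
    (hkx : ∀ k ∈ K, x * k = k * x) (hkkx : ∀ k ∈ K, ∀ l ∈ K, k * (l * x) = k * l * x)
    (hkxk : ∀ k ∈ K, ∀ l ∈ K, k * x * l = k * l * x)
    (hkxkx : ∀ k ∈ K, ∀ l ∈ K, k * x * (l * x) = γ * (k * l) + α • (δ k * l) + β • (k * δ l))
    (hkxx : ∀ k ∈ K, k * x * x = γ * k + α • δ k) (hxkx : ∀ k ∈ K, x * (k * x) = γ * k + β • δ k)
    (hxx : x * x = γ)
    (hgen : ∀ S : NonUnitalSubalgebra Φ A, (∀ z, u (z, 0) ∈ S) → x ∈ S → S = ⊤) (a : A) :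
    ∃ k ∈ NonUnitalAlgebra.adjoin Φ (Set.range u), ∃ l ∈ NonUnitalAlgebra.adjoin Φ (Set.range u),
      ∃ c : Φ, a = k + l * x + c • x := by
  set L := NonUnitalAlgebra.adjoin Φ (Set.range u) with hL
  have hLK : L ≤ K := NonUnitalAlgebra.adjoin_le (by rintro _ ⟨t, rfl⟩; exact hu t)
  -- The derivation δ only shifts the index of a generator, so it preserves L.
  have hδL : ∀ k ∈ L, δ k ∈ L := by
    intro k hk
    induction hk using NonUnitalAlgebra.adjoin_induction with
    | mem k hk =>
      obtain ⟨⟨z, i⟩, rfl⟩ := hk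
      rw [hδu]
      exact NonUnitalAlgebra.subset_adjoin Φ ⟨_, rfl⟩
    | add k l _ _ hk hl => rw [map_add]; exact add_mem hk hl
    | zero => rw [map_zero]; exact zero_mem _
    | mul k l hk hl hk' hl' =>
      rw [hδ k (hLK hk) l (hLK hl)]
      exact add_mem (mul_mem hk hl') (mul_mem hl hk')
    | smul c k _ hk => rw [map_smul]; exact SMulMemClass.smul_mem c hk
  let S : NonUnitalSubalgebra Φ A :=
    { carrier := {a | ∃ k ∈ L, ∃ l ∈ L, ∃ c : Φ, a = k + l * x + c • x}
      zero_mem' := ⟨0, zero_mem _, 0, zero_mem _, 0, by simp⟩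
      add_mem' := by
        rintro _ _ ⟨k, hk, l, hl, c, rfl⟩ ⟨k', hk', l', hl', c', rfl⟩
        refine ⟨k + k', add_mem hk hk', l + l', add_mem hl hl', c + c', ?_⟩
        rw [add_mul]
        module
      smul_mem' := by
        rintro r _ ⟨k, hk, l, hl, c, rfl⟩
        refine ⟨r • k, SMulMemClass.smul_mem r hk, r • l, SMulMemClass.smul_mem r hl, r * c, ?_⟩
        rw [smul_mul_assoc]
        module
      mul_mem' := by
        rintro _ _ ⟨k, hk, l, hl, c, rfl⟩ ⟨k', hk', l', hl', c', rfl⟩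
        -- Products of two odd terms fall into L because γ ∈ L and L is stable under δ. In the
        -- products of an even and an odd term, x has its coefficient in L, so no Φx component
        -- remains and the scalar witness is 0.
        refine ⟨k * k' + (γ * (l * l') + α • (δ l * l') + β • (l * δ l')) +
            c' • (γ * l + α • δ l) + c • (γ * l' + β • δ l') + (c * c') • γ, ?_,
          k * l' + c' • k + l * k' + c • k', ?_, 0, ?_⟩
        · exact add_mem (add_mem (add_mem (add_mem (mul_mem hk hk') (add_mem (add_mem
            (mul_mem hγ (mul_mem hl hl')) (SMulMemClass.smul_mem α (mul_mem (hδL l hl) hl')))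
            (SMulMemClass.smul_mem β (mul_mem hl (hδL l' hl')))))
            (SMulMemClass.smul_mem c' (add_mem (mul_mem hγ hl) (SMulMemClass.smul_mem α (hδL l hl)))))
            (SMulMemClass.smul_mem c (add_mem (mul_mem hγ hl') (SMulMemClass.smul_mem β (hδL l' hl')))))
            (SMulMemClass.smul_mem _ hγ)
        · exact add_mem (add_mem (add_mem (mul_mem hk hl') (SMulMemClass.smul_mem c' hk)) (mul_mem hl hk'))
            (SMulMemClass.smul_mem c hk')
        · simp only [mul_add, add_mul, smul_mul_assoc, mul_smul_comm,
            hkkx k (hLK hk) l' (hLK hl'), hkxk l (hLK hl) k' (hLK hk'),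
            hkxkx l (hLK hl) l' (hLK hl'), hkxx l (hLK hl), hxkx l' (hLK hl'), hkx k' (hLK hk'),
            hxx]
          module }
  have hS : S = ⊤ := hgen S
    (fun z => ⟨_, NonUnitalAlgebra.subset_adjoin Φ ⟨(z, 0), rfl⟩, 0, zero_mem _, 0, by simp⟩)
    ⟨0, zero_mem _, 0, zero_mem _, 1, by simp⟩
  exact (hS ▸ NonUnitalAlgebra.mem_top : a ∈ S)

variable {T : Type w} {u : T → A} {x : A}

/-- If a subalgebra generated by commuting, associating elements `u t` is mapped to polynomials
by a homomorphism with `u t ↦ X t`, then the homomorphism is injective. -/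
theorem injOn_adjoin_of_map_eq_X
    (hcomm : ∀ k ∈ NonUnitalAlgebra.adjoin Φ (Set.range u),
      ∀ l ∈ NonUnitalAlgebra.adjoin Φ (Set.range u), k * l = l * k)
    (hassoc : ∀ k ∈ NonUnitalAlgebra.adjoin Φ (Set.range u),
      ∀ l ∈ NonUnitalAlgebra.adjoin Φ (Set.range u),
      ∀ m ∈ NonUnitalAlgebra.adjoin Φ (Set.range u), k * l * m = k * (l * m))
    (f : A →ₗ[Φ] MvPolynomial T Φ) (hfu : ∀ t, f (u t) = MvPolynomial.X t)
    (hf : ∀ k ∈ NonUnitalAlgebra.adjoin Φ (Set.range u),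
      ∀ l ∈ NonUnitalAlgebra.adjoin Φ (Set.range u), f (k * l) = f k * f l)
    {k : A} (hk : k ∈ NonUnitalAlgebra.adjoin Φ (Set.range u)) (h0 : f k = 0) : k = 0 := by
  -- The generated subalgebra is a commutative ring without unit. Polynomials may have constant
  -- terms, so the evaluation at the u t takes values in its unitization.
  let _ : NonUnitalCommRing (NonUnitalAlgebra.adjoin Φ (Set.range u)) :=
    { (inferInstance : NonUnitalNonAssocRing (NonUnitalAlgebra.adjoin Φ (Set.range u))) with
      mul_assoc := fun a b c => Subtype.ext (hassoc a a.2 b b.2 c c.2)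
      mul_comm := fun a b => Subtype.ext (hcomm a a.2 b b.2) }
  let ψ : MvPolynomial T Φ →ₐ[Φ] Unitization Φ (NonUnitalAlgebra.adjoin Φ (Set.range u)) :=
    MvPolynomial.aeval fun t =>
      Unitization.inr ⟨u t, NonUnitalAlgebra.subset_adjoin Φ ⟨t, rfl⟩⟩
  -- Evaluation after f is the inclusion into the unitization: both agree on generators and are
  -- multiplicative.
  have key : ψ (f k) = Unitization.inr ⟨k, hk⟩ := by
    clear h0
    induction hk using NonUnitalAlgebra.adjoin_induction with
    | mem k hk =>
      obtain ⟨t, rfl⟩ := hk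
      rw [hfu]
      exact MvPolynomial.aeval_X _ _
    | add k l hk hl hk' hl' => rw [map_add, map_add, hk', hl', ← Unitization.inr_add]; rfl
    | zero => rw [map_zero, map_zero, ← Unitization.inr_zero]; rfl
    | mul k l hk hl hk' hl' => rw [hf k hk l hl, map_mul, hk', hl', ← Unitization.inr_mul]; rfl
    | smul c k hk hk' => rw [map_smul, map_smul, hk', ← Unitization.inr_smul]; rfl
  rw [h0, map_zero, ← Unitization.inr_zero] at key
  exact (congrArg Subtype.val (Unitization.inr_injective key)).symm

theorem constantCoeff_map_adjoin (f : A →ₗ[Φ] MvPolynomial T Φ)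
    (hfu : ∀ t, f (u t) = MvPolynomial.X t)
    (hf : ∀ k ∈ NonUnitalAlgebra.adjoin Φ (Set.range u),
      ∀ l ∈ NonUnitalAlgebra.adjoin Φ (Set.range u), f (k * l) = f k * f l)
    {k : A} (hk : k ∈ NonUnitalAlgebra.adjoin Φ (Set.range u)) :
    MvPolynomial.constantCoeff (f k) = 0 := by
  induction hk using NonUnitalAlgebra.adjoin_induction with
  | mem k hk =>
    obtain ⟨t, rfl⟩ := hk
    rw [hfu, MvPolynomial.constantCoeff_X]
  | add k l hk hl hk' hl' => rw [map_add, map_add, hk', hl', add_zero]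
  | zero => rw [map_zero, map_zero]
  | mul k l hk hl hk' hl' => rw [hf k hk l hl, map_mul, hk', zero_mul]
  | smul c k hk hk' => rw [map_smul, MvPolynomial.smul_eq_C_mul, map_mul, hk', mul_zero]

theorem exists_map_adjoin_eq (f : A →ₗ[Φ] MvPolynomial T Φ)
    (hfu : ∀ t, f (u t) = MvPolynomial.X t)
    (hf : ∀ k ∈ NonUnitalAlgebra.adjoin Φ (Set.range u),
      ∀ l ∈ NonUnitalAlgebra.adjoin Φ (Set.range u), f (k * l) = f k * f l)
    (p : MvPolynomial T Φ) :
    ∃ k ∈ NonUnitalAlgebra.adjoin Φ (Set.range u),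
      f k = p - MvPolynomial.C (MvPolynomial.constantCoeff p) := by
  induction p using MvPolynomial.induction_on with
  | C a => exact ⟨0, zero_mem _, by simp⟩
  | add p q hp hq =>
    obtain ⟨k, hk, hk'⟩ := hp
    obtain ⟨l, hl, hl'⟩ := hq
    refine ⟨k + l, add_mem hk hl, ?_⟩
    rw [map_add, hk', hl', map_add, map_add]
    ring
  | mul_X p t hp =>
    obtain ⟨k, hk, hk'⟩ := hp
    have ht : u t ∈ NonUnitalAlgebra.adjoin Φ (Set.range u) :=
      NonUnitalAlgebra.subset_adjoin Φ ⟨t, rfl⟩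
    refine ⟨k * u t + MvPolynomial.constantCoeff p • u t,
      add_mem (mul_mem hk ht) (SMulMemClass.smul_mem _ ht), ?_⟩
    rw [map_add, map_smul, hf k hk _ ht, hk', hfu, map_mul, MvPolynomial.constantCoeff_X, mul_zero,
      map_zero, MvPolynomial.smul_eq_C_mul]
    ring

/-- A linear map from an algebra of the form `L + Lx + Φx` to `Φ[T] ⊕ Φ[T]` that is
multiplicative on `L` and sends `kx` to the odd copy of `k` is injective, and its image
consists of the pairs whose even part has no constant term. -/
theorem bijective_of_map_eq_X
    (hcomm : ∀ k ∈ NonUnitalAlgebra.adjoin Φ (Set.range u),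
      ∀ l ∈ NonUnitalAlgebra.adjoin Φ (Set.range u), k * l = l * k)
    (hassoc : ∀ k ∈ NonUnitalAlgebra.adjoin Φ (Set.range u),
      ∀ l ∈ NonUnitalAlgebra.adjoin Φ (Set.range u),
      ∀ m ∈ NonUnitalAlgebra.adjoin Φ (Set.range u), k * l * m = k * (l * m))
    (hdec : ∀ a : A, ∃ k ∈ NonUnitalAlgebra.adjoin Φ (Set.range u),
      ∃ l ∈ NonUnitalAlgebra.adjoin Φ (Set.range u), ∃ c : Φ, a = k + l * x + c • x)
    (φ : A →ₗ[Φ] MvPolynomial T Φ × MvPolynomial T Φ)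
    (hφu : ∀ t, φ (u t) = (MvPolynomial.X t, 0)) (hφx : φ x = (0, 1))
    (hφ : ∀ a b, (φ a).2 = 0 → (φ b).2 = 0 → φ (a * b) = ((φ a).1 * (φ b).1, 0))
    (hφm : ∀ a, (φ a).2 = 0 → φ (a * x) = (0, (φ a).1)) :
    Function.Injective φ ∧ (∀ a, MvPolynomial.constantCoeff (φ a).1 = 0) ∧
      ∀ p q, MvPolynomial.constantCoeff p = 0 → ∃ a, φ a = (p, q) := by
  let f : A →ₗ[Φ] MvPolynomial T Φ := LinearMap.fst Φ _ _ ∘ₗ φ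
  have h2 : ∀ k ∈ NonUnitalAlgebra.adjoin Φ (Set.range u), (φ k).2 = 0 := by
    intro k hk
    induction hk using NonUnitalAlgebra.adjoin_induction with
    | mem k hk =>
      obtain ⟨t, rfl⟩ := hk
      rw [hφu]
    | add k l hk hl hk' hl' => rw [map_add, Prod.snd_add, hk', hl', add_zero]
    | zero => rw [map_zero]; rfl
    | mul k l hk hl hk' hl' => rw [hφ k l hk' hl']
    | smul c k hk hk' => rw [map_smul, Prod.smul_snd, hk', smul_zero]
  have hfu : ∀ t, f (u t) = MvPolynomial.X t := fun t => congrArg Prod.fst (hφu t)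
  have hf : ∀ k ∈ NonUnitalAlgebra.adjoin Φ (Set.range u),
      ∀ l ∈ NonUnitalAlgebra.adjoin Φ (Set.range u), f (k * l) = f k * f l :=
    fun k hk l hl => congrArg Prod.fst (hφ k l (h2 k hk) (h2 l hl))
  have hval : ∀ k ∈ NonUnitalAlgebra.adjoin Φ (Set.range u),
      ∀ l ∈ NonUnitalAlgebra.adjoin Φ (Set.range u), ∀ c : Φ,
      φ (k + l * x + c • x) = (f k, f l + MvPolynomial.C c) := by
    intro k hk l hl c
    rw [map_add, map_add, map_smul, hφm l (h2 l hl), hφx]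
    refine Prod.ext ?_ ?_
    · change f k + 0 + c • 0 = f k
      rw [smul_zero, add_zero, add_zero]
    · change (φ k).2 + f l + c • 1 = f l + MvPolynomial.C c
      rw [h2 k hk, zero_add, MvPolynomial.smul_eq_C_mul, mul_one]
  refine ⟨?_, ?_, ?_⟩
  · rw [injective_iff_map_eq_zero]
    intro a ha
    obtain ⟨k, hk, l, hl, c, rfl⟩ := hdec a
    rw [hval k hk l hl c, Prod.mk_eq_zero] at ha
    -- The scalar c is the constant term of the odd coordinate, since f l has none.
    have hc : c = 0 := by
      have e := congrArg MvPolynomial.constantCoeff ha.2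
      rwa [map_add, constantCoeff_map_adjoin f hfu hf hl, MvPolynomial.constantCoeff_C, zero_add,
        map_zero] at e
    rw [hc, map_zero, add_zero] at ha
    rw [injOn_adjoin_of_map_eq_X hcomm hassoc f hfu hf hk ha.1,
      injOn_adjoin_of_map_eq_X hcomm hassoc f hfu hf hl ha.2, hc]
    simp
  · intro a
    obtain ⟨k, hk, l, hl, c, rfl⟩ := hdec a
    rw [hval k hk l hl c]
    exact constantCoeff_map_adjoin f hfu hf hk
  · intro p q hp
    obtain ⟨k, hk, hk'⟩ := exists_map_adjoin_eq f hfu hf p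
    obtain ⟨l, hl, hl'⟩ := exists_map_adjoin_eq f hfu hf q
    -- The image of L reaches q only up to its constant term, which the summand Φx supplies.
    refine ⟨k + l * x + MvPolynomial.constantCoeff q • x, ?_⟩
    rw [hval k hk l hl, hk', hl', hp, map_zero, sub_zero, sub_add_cancel]

end Generated

end VectorSuper

/-! ### The operator R_{x,x} and homogeneous elements -/

namespace VectorSuper

universe u v w

open Superalgebra

/-- The operator `R_{x,x}` as a linear map. -/
def rxx (Φ : Type u) {A : Type v} [Field Φ] [NonUnitalNonAssocRing A] [Module Φ A]
    [IsScalarTower Φ A A] (x : A) : A →ₗ[Φ] A where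
  toFun := Rxx x
  map_add' a b := by simp only [Rxx, add_mul]; abel
  map_smul' c a := by simp only [Rxx, smul_mul_assoc, smul_sub, RingHom.id_apply]

theorem rxx_apply {Φ : Type u} {A : Type v} [Field Φ] [NonUnitalNonAssocRing A] [Module Φ A]
    [IsScalarTower Φ A A] (x a : A) : rxx Φ x a = a * x * x - a * (x * x) := rfl

section Homogeneous

variable {Φ : Type u} {A : Type v} [Field Φ] [NonUnitalNonAssocRing A] [Module Φ A]
  [Superalgebra Φ A]

variable (Φ) in
theorem homogeneous_induction {P : A → Prop} (add : ∀ a b, P a → P b → P (a + b))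
    (mem : ∀ (i : ZMod 2) (a : A), a ∈ grade (Φ := Φ) i → P a) (a : A) : P a := by
  rw [← sub_add_cancel a (oddPart Φ A a)]
  exact add _ _ (mem 0 _ (sub_oddPart_mem a)) (mem 1 _ (oddPart_mem a))

theorem even_mul_mem {i : ZMod 2} {w a : A} (hw : w ∈ grade (Φ := Φ) 0)
    (ha : a ∈ grade (Φ := Φ) i) : w * a ∈ grade (Φ := Φ) i := by
  simpa using mul_mem hw ha

theorem odd_mul_odd_mem {a b : A} (ha : a ∈ grade (Φ := Φ) 1)
    (hb : b ∈ grade (Φ := Φ) 1) : a * b ∈ grade (Φ := Φ) 0 := by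
  simpa using mul_mem ha hb

theorem mul_odd_mul_odd_mem {i : ZMod 2} {a x : A} (ha : a ∈ grade (Φ := Φ) i)
    (hx : x ∈ grade (Φ := Φ) 1) : a * x * x ∈ grade (Φ := Φ) i := by
  simpa [add_assoc] using mul_mem (mul_mem ha hx) hx

end Homogeneous

/-! ### Skew elements of Jordan superalgebras -/

section Jordan

variable {Φ : Type u} {A : Type v} [Field Φ] [NonUnitalNonAssocRing A] [Module Φ A]
  [Superalgebra Φ A]

variable (Φ) in
/-- The even elements `w` for which the associator `(w, a, b)` is superskewsymmetric in `a`, `b`. -/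
def IsSkew (w : A) : Prop :=
  w ∈ grade (Φ := Φ) 0 ∧ ∀ (i j : ZMod 2) (a b : A), a ∈ grade (Φ := Φ) i →
    b ∈ grade (Φ := Φ) j → assoc w a b + koszul Φ i j • assoc w b a = 0

namespace SuperJordan

variable (hA : SuperJordan Φ A)
include hA

theorem mul_comm_smul {i j : ZMod 2} {a b : A} (ha : a ∈ grade (Φ := Φ) i)
    (hb : b ∈ grade (Φ := Φ) j) : a * b = koszul Φ i j • (b * a) :=
  sub_eq_zero.1 (hA.supercomm i j a b ha hb)

theorem even_mul_comm {w : A} (hw : w ∈ grade (Φ := Φ) 0) (a : A) : w * a = a * w := by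
  refine homogeneous_induction Φ (P := fun a => w * a = a * w)
    (fun a b ha hb => by rw [mul_add, add_mul, ha, hb]) (fun i a ha => ?_) a
  rw [hA.mul_comm_smul hw ha, koszul_zero_left, one_smul]

theorem odd_mul_self (h2 : (2 : Φ) ≠ 0) {x : A} (hx : x ∈ grade (Φ := Φ) 1) : x * x = 0 := by
  have e := hA.mul_comm_smul hx hx
  rw [koszul_one_one, neg_one_smul] at e
  have e2 : (2 : Φ) • (x * x) = 0 := by
    rw [two_smul]
    nth_rewrite 1 [e]
    exact neg_add_cancel _
  exact (smul_eq_zero.1 e2).resolve_left h2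

section

variable [SMulCommClass Φ A A]

/-- By supercommutativity the subtracted terms w(ab) and ±w(ba) coincide. The resulting relation can
be used linearly to eliminate products. -/
theorem isSkew_iff {w : A} (hw : w ∈ grade (Φ := Φ) 0) : IsSkew Φ w ↔
    ∀ (i j : ZMod 2) (a b : A), a ∈ grade (Φ := Φ) i → b ∈ grade (Φ := Φ) j →
      w * a * b + koszul Φ i j • (w * b * a) = (2 : Φ) • (w * (a * b)) := by
  have key : ∀ (i j : ZMod 2) (a b : A), a ∈ grade (Φ := Φ) i → b ∈ grade (Φ := Φ) j →
      assoc w a b + koszul Φ i j • assoc w b a =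
        w * a * b + koszul Φ i j • (w * b * a) - (2 : Φ) • (w * (a * b)) := by
    intro i j a b ha hb
    have e : koszul Φ i j • (w * (b * a)) = w * (a * b) := by
      rw [hA.mul_comm_smul ha hb, mul_smul_comm]
    rw [assoc, assoc, smul_sub, e]
    module
  constructor
  · intro h i j a b ha hb
    rw [← sub_eq_zero, ← key i j a b ha hb]
    exact h.2 i j a b ha hb
  · intro h
    refine ⟨hw, fun i j a b ha hb => ?_⟩
    rw [key i j a b ha hb, h i j a b ha hb, sub_self]

theorem skew_mul {w : A} (hw : IsSkew Φ w) {i j : ZMod 2} {a b : A} (ha : a ∈ grade (Φ := Φ) i)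
    (hb : b ∈ grade (Φ := Φ) j) :
    w * a * b + koszul Φ i j • (w * b * a) = (2 : Φ) • (w * (a * b)) :=
  (hA.isSkew_iff hw.1).1 hw i j a b ha hb

theorem skew_mul_skew_mul (h3 : (3 : Φ) ≠ 0) {w w' : A} (hw : IsSkew Φ w) (hw' : IsSkew Φ w')
    (c : A) : w * (w' * c) = w * w' * c := by
  refine homogeneous_induction Φ (P := fun c => w * (w' * c) = w * w' * c)
    (fun a b ha hb => by simp only [mul_add, ha, hb]) (fun i c hc => ?_) c
  -- With A = w(w'c), B = w'(wc) and P = (ww')c, skewness of w and of w' gives P + B = 2A and P + A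
  -- = 2B, whence 3(A − P) = 0.
  have r1 := hA.skew_mul hw hw'.1 hc
  have r2 := hA.skew_mul hw' hw.1 hc
  rw [koszul_zero_left, one_smul, ← hA.even_mul_comm hw'.1 (w * c)] at r1
  rw [koszul_zero_left, one_smul, ← hA.even_mul_comm hw.1 (w' * c),
    hA.even_mul_comm hw'.1 w] at r2
  have e : (3 : Φ) • (w * (w' * c) - w * w' * c) = 0 := by
    linear_combination (norm := module) -(2 : Φ) • r1 - r2
  exact sub_eq_zero.1 ((smul_eq_zero.1 e).resolve_left h3)

theorem skew_left_comm (h3 : (3 : Φ) ≠ 0) {w w' : A} (hw : IsSkew Φ w) (hw' : IsSkew Φ w')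
    (c : A) : w' * (w * c) = w * w' * c := by
  rw [hA.skew_mul_skew_mul h3 hw' hw, hA.even_mul_comm hw'.1]

/-- Skewness of the factors at arguments multiplied by w or w', together with the Jordan identity at
w, w', b, a, gives a linear system. The mixed terms, such as (wa)(w'b) and w((w'a)b), are eliminated
and three times the desired relation is left. -/
theorem isSkew_mul (h3 : (3 : Φ) ≠ 0) {w w' : A} (hw : IsSkew Φ w) (hw' : IsSkew Φ w') :
    IsSkew Φ (w * w') := by
  refine (hA.isSkew_iff (even_mul_mem hw.1 hw'.1)).2 fun i j a b ha hb => ?_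
  have he : koszul Φ i j * koszul Φ i j = 1 := koszul_mul_self i j
  have hwa := even_mul_mem hw.1 ha
  have hwb := even_mul_mem hw.1 hb
  have hwa' := even_mul_mem hw'.1 ha
  have hwb' := even_mul_mem hw'.1 hb
  have r1 := hA.skew_mul hw hwa' hb
  have r2 := hA.skew_mul hw ha hwb'
  have r4 := hA.skew_mul hw' ha hwb
  have r5 := congrArg (w * ·) (hA.skew_mul hw' ha hb)
  have r7 := hA.jordan 0 0 j i w w' b a hw.1 hw'.1 hb ha
  rw [hA.skew_mul_skew_mul h3 hw hw', hA.mul_comm_smul hwb hwa', koszul_comm j i, smul_smul, he,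
    one_smul] at r1
  rw [hA.skew_mul_skew_mul h3 hw hw', hA.mul_comm_smul ha hwb', mul_smul_comm] at r2
  rw [hA.skew_left_comm h3 hw hw', hA.mul_comm_smul ha hwb, mul_smul_comm] at r4
  simp only [mul_add, mul_smul_comm, hA.skew_mul_skew_mul h3 hw hw'] at r5
  simp only [superJordan, assoc, koszul_zero_left, koszul_zero_right, one_mul, mul_one,
    koszul_comm j i] at r7
  rw [← hA.even_mul_comm hw.1 (w' * b * a), ← hA.even_mul_comm hw.1 a,
    hA.mul_comm_smul hwb' hwa, ← hA.even_mul_comm hw.1 b, ← hA.even_mul_comm hw'.1 (w * b * a),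
    ← hA.even_mul_comm hw'.1 a, hA.mul_comm_smul hwb hwa', koszul_comm j i] at r7
  simp only [smul_sub, smul_smul, he, one_smul] at r7
  generalize koszul Φ i j = e at *
  have key : (3 : Φ) • (w * w' * a * b + e • (w * w' * b * a) -
      (2 : Φ) • (w * w' * (a * b))) = 0 := by
    linear_combination (norm := module) (2 : Φ) • r7 + r1 + (2 : Φ) • r2 + r4 + (2 : Φ) • r5
  exact sub_eq_zero.1 ((smul_eq_zero.1 key).resolve_left h3)

end

variable [IsScalarTower Φ A A]

theorem rxx_apply_odd (h2 : (2 : Φ) ≠ 0) {x : A} (hx : x ∈ grade (Φ := Φ) 1) (a : A) :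
    rxx Φ x a = a * x * x := by
  rw [rxx_apply, hA.odd_mul_self h2 hx, mul_zero, sub_zero]

/-- Since x² = 0, the operator is R_x². The Jordan identity at a, b, x, x yields the Leibniz rule:
its two products of ax with bx cancel by supercommutativity. -/
theorem rxx_mul (h2 : (2 : Φ) ≠ 0) {x : A} (hx : x ∈ grade (Φ := Φ) 1) (a b : A) :
    rxx Φ x (a * b) = rxx Φ x a * b + a * rxx Φ x b := by
  refine homogeneous_induction Φ
    (P := fun a => rxx Φ x (a * b) = rxx Φ x a * b + a * rxx Φ x b)
    (fun a a' ha hb => by simp only [add_mul, map_add, ha, hb]; abel) (fun i a ha => ?_) a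
  refine homogeneous_induction Φ
    (P := fun b => rxx Φ x (a * b) = rxx Φ x a * b + a * rxx Φ x b)
    (fun a a' ha hb => by simp only [mul_add, map_add, ha, hb]; abel) (fun j b hb => ?_) b
  simp only [hA.rxx_apply_odd h2 hx]
  have r := hA.jordan i j 1 1 a b x x ha hb hx hx
  have c1 := hA.mul_comm_smul (mul_odd_mul_odd_mem hb hx) ha
  have c2 := hA.mul_comm_smul hx ha
  have c3 := hA.mul_comm_smul (mul_mem hb hx) (mul_mem ha hx)
  have c4 := hA.mul_comm_smul hx hb
  simp only [superJordan, assoc, hA.odd_mul_self h2 hx, mul_zero, sub_zero] at r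
  rw [c1, c2, c4] at r
  rcases zmod_two_cases i with rfl | rfl <;> rcases zmod_two_cases j with rfl | rfl <;>
    simp only [koszul_zero_left, koszul_zero_right, koszul_one_one, one_smul, mul_one,
      zero_add, zmod_two_one_add_one, neg_smul, mul_neg, neg_neg, neg_mul] at r c3 <;>
    rw [c3] at r <;>
    linear_combination (norm := module) r

variable [SMulCommClass Φ A A]

theorem isSkew_rxx (h2 : (2 : Φ) ≠ 0) {x w : A} (hx : x ∈ grade (Φ := Φ) 1) (hw : IsSkew Φ w) :
    IsSkew Φ (rxx Φ x w) := by
  have hmem : ∀ {i : ZMod 2} {a : A}, a ∈ grade (Φ := Φ) i → rxx Φ x a ∈ grade (Φ := Φ) i := by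
    intro i a ha
    rw [hA.rxx_apply_odd h2 hx]
    exact mul_odd_mul_odd_mem ha hx
  refine (hA.isSkew_iff (hmem hw.1)).2 fun i j a b ha hb => ?_
  -- The derivation is applied to the skew relation for w; the terms where it hits a or b are
  -- instances of that relation and are subtracted.
  have r := congrArg (rxx Φ x) (hA.skew_mul hw ha hb)
  have r1 := hA.skew_mul hw (hmem ha) hb
  have r2 := hA.skew_mul hw ha (hmem hb)
  simp only [map_add, map_smul, hA.rxx_mul h2 hx, mul_add, add_mul] at r
  linear_combination (norm := module) r - r1 - r2

/-- The subalgebra of skew elements. -/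
def skewSubalgebra (h3 : (3 : Φ) ≠ 0) : NonUnitalSubalgebra Φ A where
  carrier := {w | IsSkew Φ w}
  zero_mem' := ⟨zero_mem _, fun i j a b _ _ => by simp [assoc]⟩
  add_mem' := by
    intro w w' hw hw'
    refine ⟨add_mem hw.1 hw'.1, fun i j a b ha hb => ?_⟩
    have r1 := hw.2 i j a b ha hb
    have r2 := hw'.2 i j a b ha hb
    simp only [assoc, add_mul] at r1 r2 ⊢
    linear_combination (norm := module) r1 + r2
  smul_mem' := by
    intro c w hw
    refine ⟨Submodule.smul_mem _ c hw.1, fun i j a b ha hb => ?_⟩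
    have r1 := hw.2 i j a b ha hb
    simp only [assoc, smul_mul_assoc] at r1 ⊢
    linear_combination (norm := module) c • r1
  mul_mem' := fun hw hw' => hA.isSkew_mul h3 hw hw'

theorem odd_mul_odd (h2 : (2 : Φ) ≠ 0) (h3 : (3 : Φ) ≠ 0) {x k l : A}
    (hx : x ∈ grade (Φ := Φ) 1) (hk : IsSkew Φ k) (hl : IsSkew Φ l) :
    k * x * (l * x) = rxx Φ x k * l - k * rxx Φ x l := by
  -- Writing R = R_{x,x}, skewness of k at lx, x reads R(kl) − kx · lx = 2kR(l); the Leibniz rule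
  -- for R(kl) gives the claim.
  have r := hA.skew_mul hk (even_mul_mem hl.1 hx) hx
  have d := hA.rxx_mul h2 hx k l
  rw [hA.skew_mul_skew_mul h3 hk hl, koszul_one_one] at r
  simp only [hA.rxx_apply_odd h2 hx] at d ⊢
  linear_combination (norm := module) d - r

theorem skew_generated (h2 : (2 : Φ) ≠ 0) (h3 : (3 : Φ) ≠ 0) {Z : Type w} {z : Z → A}
    (hz : ∀ g, IsSkew Φ (z g)) {x : A} (hx : x ∈ grade (Φ := Φ) 1)
    (hgen : ∀ S : NonUnitalSubalgebra Φ A, (∀ g, z g ∈ S) → x ∈ S → S = ⊤) :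
    let L := NonUnitalAlgebra.adjoin Φ
      (Set.range fun h : Z × ℕ => (Rxx x)^[h.2] (z h.1))
    (∀ k ∈ L, ∀ l ∈ L, k * l = l * k) ∧ (∀ k ∈ L, ∀ l ∈ L, ∀ m ∈ L, k * l * m = k * (l * m)) ∧
      ∀ a : A, ∃ k ∈ L, ∃ l ∈ L, ∃ c : Φ, a = k + l * x + c • x := by
  intro L
  let K := hA.skewSubalgebra h3
  have hu : ∀ h : Z × ℕ, (Rxx x)^[h.2] (z h.1) ∈ K := by
    rintro ⟨g, n⟩
    induction n with
    | zero => exact hz g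
    | succ n ih =>
      dsimp only at ih ⊢
      rw [Function.iterate_succ_apply']
      exact hA.isSkew_rxx h2 hx ih
  have hLK : L ≤ K := NonUnitalAlgebra.adjoin_le (by rintro _ ⟨t, rfl⟩; exact hu t)
  have hcomm : ∀ k ∈ K, ∀ l : A, k * l = l * k := fun k hk l => hA.even_mul_comm hk.1 l
  have hxk : ∀ k ∈ K, x * (k * x) = -rxx Φ x k := by
    intro k hk
    rw [hA.rxx_apply_odd h2 hx, hA.mul_comm_smul hx (even_mul_mem hk.1 hx), koszul_one_one,
      neg_one_smul]
  refine ⟨fun k hk l _ => hcomm k (hLK hk) l,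
    fun k hk l hl m _ => (hA.skew_mul_skew_mul h3 (hLK hk) (hLK hl) m).symm, ?_⟩
  -- Here γ = x² = 0, and kx · lx = R(k)l − kR(l) with R = R_{x,x} gives α = 1, β = −1.
  refine exists_eq_add_mul_add_smul (K := K) (x := x) (γ := 0) (α := (1 : Φ)) (β := -1) hu
    (δ := rxx Φ x) ?_ ?_ (zero_mem _) (fun k hk => (hcomm k hk x).symm)
    (fun k hk l hl => hA.skew_mul_skew_mul h3 hk hl x) ?_ ?_ ?_ ?_ (hA.odd_mul_self h2 hx) ?_
  · intro k hk l hl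
    rw [hA.rxx_mul h2 hx, hcomm l hl, add_comm]
  · intro g i
    exact (Function.iterate_succ_apply' _ _ _).symm
  · intro k hk l hl
    rw [← hcomm l hl, hA.skew_left_comm h3 hk hl]
  · intro k hk l hl
    rw [hA.odd_mul_odd h2 h3 hx hk hl, zero_mul]
    module
  · intro k hk
    rw [hA.rxx_apply_odd h2 hx, zero_mul]
    module
  · intro k hk
    rw [hxk k hk, zero_mul]
    module
  · intro S h1 h2
    exact hgen S h1 h2

end SuperJordan

end Jordan

end VectorSuper

namespace VectorSuper

universe u v w

open Superalgebra

/-! ### Central elements of strongly (-1,1)-superalgebras -/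

section Strong

variable {Φ : Type u} {A : Type v} [Field Φ] [NonUnitalNonAssocRing A] [Module Φ A]
  [Superalgebra Φ A]

variable (Φ) in
/-- The even elements that commute with everything. -/
def IsEvenCentral (w : A) : Prop := w ∈ grade (Φ := Φ) 0 ∧ ∀ a : A, w * a = a * w

namespace SuperStrong

variable (hA : SuperStrong Φ A)
include hA

/-- Linearized right alternativity (a, b, w) + (a, w, b) = 0, with every outer factor w moved to the
left. -/
theorem central_mul {w : A} (hw : IsEvenCentral Φ w) (a b : A) :
    w * a * b + w * (a * b) = (2 : Φ) • (a * (w * b)) := by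
  refine homogeneous_induction Φ
    (P := fun a => w * a * b + w * (a * b) = (2 : Φ) • (a * (w * b))) (fun a a' ha ha' => ?_)
    (fun i a ha => ?_) a
  · simp only [mul_add, add_mul, smul_add, ← ha, ← ha']
    abel
  refine homogeneous_induction Φ
    (P := fun b => w * a * b + w * (a * b) = (2 : Φ) • (a * (w * b))) (fun a a' ha ha' => ?_)
    (fun j b hb => ?_) b
  · simp only [mul_add, smul_add, ← ha, ← ha']
    abel
  have r := hA.rightAlt i j 0 a b w ha hb hw.1
  simp only [superRightAlt, assoc, koszul_zero_right, one_smul] at r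
  rw [← hw.2 (a * b), ← hw.2 a, ← hw.2 b] at r
  linear_combination (norm := module) r

theorem central_left_comm (h3 : (3 : Φ) ≠ 0) {w w' : A} (hw : IsEvenCentral Φ w)
    (hw' : IsEvenCentral Φ w') (c : A) : w' * (w * c) = w * (w' * c) := by
  have r1 := hA.central_mul hw w' c
  have r2 := hA.central_mul hw' w c
  rw [hw'.2 w] at r2
  have e : (3 : Φ) • (w' * (w * c) - w * (w' * c)) = 0 := by
    linear_combination (norm := module) r2 - r1
  exact sub_eq_zero.1 ((smul_eq_zero.1 e).resolve_left h3)

theorem central_mul_central_mul (h3 : (3 : Φ) ≠ 0) {w w' : A} (hw : IsEvenCentral Φ w)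
    (hw' : IsEvenCentral Φ w') (c : A) : w * (w' * c) = w * w' * c := by
  have r1 := hA.central_mul hw w' c
  rw [hA.central_left_comm h3 hw hw'] at r1
  linear_combination (norm := module) -r1

/-- `central_mul` for w at c, w' expresses 2c(ww') as w'(wc) + w(w'c), and both summands equal
(ww')c. -/
theorem isEvenCentral_mul (h2 : (2 : Φ) ≠ 0) (h3 : (3 : Φ) ≠ 0) {w w' : A}
    (hw : IsEvenCentral Φ w) (hw' : IsEvenCentral Φ w') : IsEvenCentral Φ (w * w') := by
  refine ⟨even_mul_mem hw.1 hw'.1, fun c => ?_⟩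
  have r := hA.central_mul hw c w'
  rw [← hw'.2 (w * c), ← hw'.2 c, hA.central_left_comm h3 hw hw',
    hA.central_mul_central_mul h3 hw hw'] at r
  have e : (2 : Φ) • (w * w' * c - c * (w * w')) = 0 := by
    linear_combination (norm := module) r
  exact sub_eq_zero.1 ((smul_eq_zero.1 e).resolve_left h2)

/-- For odd elements the supercommutator is ab + ba, and [[p, q], r] = 0 makes it central. This is
the source of the centrality of x² and of R_{x,x}k. -/
theorem isEvenCentral_superComm {a b : A} (ha : a ∈ grade (Φ := Φ) 1)
    (hb : b ∈ grade (Φ := Φ) 1) : IsEvenCentral Φ (a * b + b * a) := by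
  refine ⟨add_mem (odd_mul_odd_mem ha hb) (odd_mul_odd_mem hb ha), fun c => ?_⟩
  refine homogeneous_induction Φ (P := fun c => (a * b + b * a) * c = c * (a * b + b * a))
    (fun c c' hc hc' => by rw [mul_add, hc, hc', add_mul]) (fun k c hc => ?_) c
  have r := hA.supercomm 1 1 k a b c ha hb hc
  simpa [superComm, sub_eq_zero] using r

theorem odd_mul_central_mul_odd [IsScalarTower Φ A A] (h2 : (2 : Φ) ≠ 0) {k : A}
    (hk : IsEvenCentral Φ k) (x : A) :
    x * (k * x) = x * x * k + (2⁻¹ : Φ) • rxx Φ x k := by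
  have r := hA.central_mul hk x x
  rw [rxx_apply, ← hk.2 (x * x)]
  have e : (2⁻¹ : Φ) • (2 : Φ) • (x * (k * x)) = x * (k * x) := by
    rw [smul_smul, inv_mul_cancel₀ h2, one_smul]
  have e' : (2⁻¹ : Φ) • (2 : Φ) • (k * (x * x)) = k * (x * x) := by
    rw [smul_smul, inv_mul_cancel₀ h2, one_smul]
  linear_combination (norm := module) -(2⁻¹ : Φ) • r - e + e'

variable [IsScalarTower Φ A A] [SMulCommClass Φ A A]

/-- The subalgebra of even central elements. -/
def centralSubalgebra (h2 : (2 : Φ) ≠ 0) (h3 : (3 : Φ) ≠ 0) : NonUnitalSubalgebra Φ A where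
  carrier := {w | IsEvenCentral Φ w}
  zero_mem' := ⟨zero_mem _, fun a => by rw [zero_mul, mul_zero]⟩
  add_mem' hw hw' := ⟨add_mem hw.1 hw'.1, fun a => by rw [add_mul, mul_add, hw.2, hw'.2]⟩
  smul_mem' c _ hw := ⟨Submodule.smul_mem _ c hw.1, fun a => by
    rw [smul_mul_assoc, mul_smul_comm, hw.2]⟩
  mul_mem' hw hw' := hA.isEvenCentral_mul h2 h3 hw hw'

section Odd

variable (h2 : (2 : Φ) ≠ 0) (h3 : (3 : Φ) ≠ 0) {x k l : A} (hx : x ∈ grade (Φ := Φ) 1)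
  (hk : IsEvenCentral Φ k) (hl : IsEvenCentral Φ l)
include h2

include h3 hx in
theorem isEvenCentral_odd_sq : IsEvenCentral Φ (x * x) := by
  have h := (hA.centralSubalgebra h2 h3).toSubmodule.smul_mem (2⁻¹ : Φ)
    (hA.isEvenCentral_superComm hx hx)
  change IsEvenCentral Φ _ at h
  rwa [← two_smul Φ, smul_smul, inv_mul_cancel₀ h2, one_smul] at h

include h3 hx hk in
theorem isEvenCentral_rxx : IsEvenCentral Φ (rxx Φ x k) := by
  let K := hA.centralSubalgebra h2 h3
  have hs : x * x ∈ K := hA.isEvenCentral_odd_sq h2 h3 hx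
  have hk' : k ∈ K := hk
  have hc : k * x * x + x * (k * x) ∈ K :=
    hA.isEvenCentral_superComm (even_mul_mem hk.1 hx) hx
  -- With R = R_{x,x}, one has (kx)x = R(k) + kx² and x(kx) = x²k + ½R(k). So the central element
  -- (kx)x + x(kx) equals 2kx² + (3/2)R(k), and solving for R(k) shows that it is central.
  have e : rxx Φ x k = (3⁻¹ : Φ) • ((2 : Φ) • (k * x * x + x * (k * x)) -
      (4 : Φ) • (k * (x * x))) := by
    rw [hA.odd_mul_central_mul_odd h2 hk, ← hk.2 (x * x), smul_add, smul_add, smul_smul,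
      mul_inv_cancel₀ h2, one_smul, rxx_apply, eq_inv_smul_iff₀ h3]
    module
  rw [e]
  exact K.toSubmodule.smul_mem _ (K.toSubmodule.sub_mem (K.toSubmodule.smul_mem _ hc)
    (K.toSubmodule.smul_mem _ (K.mul_mem hk' hs)))

include h3 hx hk hl in
theorem rxx_mul_and_odd_mul_odd :
    rxx Φ x (k * l) = k * rxx Φ x l + l * rxx Φ x k ∧
      k * x * (l * x) = x * x * (k * l) + rxx Φ x k * l + (2⁻¹ : Φ) • (k * rxx Φ x l) := by
  have hs := hA.isEvenCentral_odd_sq h2 h3 hx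
  -- The unknowns kx · lx and k(x(lx)) are eliminated from r1, r2, r3 to give the Leibniz rule; then
  -- r1 determines kx · lx.
  have r1 := hA.central_mul hl (k * x) x
  have r2 := hA.rightAlt 0 1 1 k x (l * x) hk.1 hx (even_mul_mem hl.1 hx)
  have r3 := congrArg (k * ·) (hA.central_mul hl x x)
  have e1 : rxx Φ x k * l = l * rxx Φ x k := (hl.2 _).symm
  have e2 : x * x * (k * l) = k * l * (x * x) := hs.2 _
  have e3 : l * (k * (x * x)) = k * l * (x * x) := by
    rw [hA.central_mul_central_mul h3 hl hk, hl.2]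
  have e4 : k * (l * (x * x)) = k * l * (x * x) := hA.central_mul_central_mul h3 hk hl _
  rw [hA.central_mul_central_mul h3 hl hk, hl.2] at r1
  simp only [superRightAlt, assoc, koszul_one_one, neg_one_smul,
    hA.central_mul_central_mul h3 hk hl] at r2
  simp only [mul_add, mul_smul_comm, e4] at r3
  have d : rxx Φ x (k * l) = k * rxx Φ x l + l * rxx Φ x k := by
    simp only [rxx_apply, mul_sub, e3, e4]
    linear_combination (norm := module) -r1 - (2 : Φ) • r2 + r3
  refine ⟨d, ?_⟩
  have e5 : (2 : Φ) • (2⁻¹ : Φ) • (k * rxx Φ x l) = k * rxx Φ x l := by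
    rw [smul_smul, mul_inv_cancel₀ h2, one_smul]
  have key : (2 : Φ) • (k * x * (l * x) -
      (x * x * (k * l) + rxx Φ x k * l + (2⁻¹ : Φ) • (k * rxx Φ x l))) = 0 := by
    rw [smul_sub, smul_add, e5, e1, e2]
    simp only [rxx_apply, mul_sub, e3, e4] at d ⊢
    linear_combination (norm := module) -r1 + d
  exact sub_eq_zero.1 ((smul_eq_zero.1 key).resolve_left h2)

end Odd

theorem central_generated (h2 : (2 : Φ) ≠ 0) (h3 : (3 : Φ) ≠ 0) {Z : Type w} {z : Option Z → A}
    (hz : ∀ g, IsEvenCentral Φ (z (some g))) {x : A} (hx : x ∈ grade (Φ := Φ) 1)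
    (hzx : z none = x * x)
    (hgen : ∀ S : NonUnitalSubalgebra Φ A, (∀ g, z (some g) ∈ S) → x ∈ S → S = ⊤) :
    let L := NonUnitalAlgebra.adjoin Φ
      (Set.range fun h : Option Z × ℕ => (fun a => (4⁻¹ : Φ) • Rxx x a)^[h.2] (z h.1))
    (∀ k ∈ L, ∀ l ∈ L, k * l = l * k) ∧ (∀ k ∈ L, ∀ l ∈ L, ∀ m ∈ L, k * l * m = k * (l * m)) ∧
      ∀ a : A, ∃ k ∈ L, ∃ l ∈ L, ∃ c : Φ, a = k + l * x + c • x := by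
  intro L
  let K := hA.centralSubalgebra h2 h3
  have h4 : (4 : Φ) ≠ 0 := by
    have e : (4 : Φ) = 2 * 2 := by norm_num
    rw [e]
    exact mul_ne_zero h2 h2
  have hu : ∀ h : Option Z × ℕ, (fun a => (4⁻¹ : Φ) • Rxx x a)^[h.2] (z h.1) ∈ K := by
    rintro ⟨g, n⟩
    induction n with
    | zero =>
      rcases g with _ | g
      · exact hzx ▸ hA.isEvenCentral_odd_sq h2 h3 hx
      · exact hz g
    | succ n ih =>
      dsimp only at ih ⊢
      rw [Function.iterate_succ_apply']
      exact K.toSubmodule.smul_mem _ (hA.isEvenCentral_rxx h2 h3 hx ih)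
  have hLK : L ≤ K := NonUnitalAlgebra.adjoin_le (by rintro _ ⟨t, rfl⟩; exact hu t)
  -- Unlike the Jordan case, γ = x² need not vanish; it lies in L because x² is adjoined as the
  -- generator with index `none`.
  have hγ : x * x ∈ L := NonUnitalAlgebra.subset_adjoin Φ ⟨(none, 0), hzx⟩
  have hcomm : ∀ k ∈ K, ∀ l : A, k * l = l * k := fun k hk l => hk.2 l
  refine ⟨fun k hk l _ => hcomm k (hLK hk) l,
    fun k hk l hl m _ => (hA.central_mul_central_mul h3 (hLK hk) (hLK hl) m).symm, ?_⟩
  -- For δ = ¼R_{x,x} the coefficients 1 and ½ of R_{x,x} become α = 4 and β = 2.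
  refine exists_eq_add_mul_add_smul (K := K) (x := x) (γ := x * x) (α := (4 : Φ)) (β := 2) hu
    (δ := (4⁻¹ : Φ) • rxx Φ x) ?_ ?_ hγ (fun k hk => (hcomm k hk x).symm)
    (fun k hk l hl => hA.central_mul_central_mul h3 hk hl x) ?_ ?_ ?_ ?_ rfl ?_
  · intro k hk l hl
    simp only [LinearMap.smul_apply, (hA.rxx_mul_and_odd_mul_odd h2 h3 hx hk hl).1, smul_add,
      mul_smul_comm]
  · intro g i
    exact (Function.iterate_succ_apply' _ _ _).symm
  · intro k hk l hl
    rw [← hcomm l hl, hA.central_mul_central_mul h3 hl hk, hcomm l hl]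
  · intro k hk l hl
    have e : (2 : Φ) * 4⁻¹ = 2⁻¹ := by
      field_simp
      norm_num
    rw [(hA.rxx_mul_and_odd_mul_odd h2 h3 hx hk hl).2]
    simp only [LinearMap.smul_apply, smul_mul_assoc, mul_smul_comm, smul_smul,
      mul_inv_cancel₀ h4, one_smul, e]
  · intro k hk
    rw [LinearMap.smul_apply, smul_smul, mul_inv_cancel₀ h4, one_smul, rxx_apply,
      hcomm k hk (x * x)]
    abel
  · intro k hk
    have e : (2 : Φ) * 4⁻¹ = 2⁻¹ := by
      field_simp
      norm_num
    rw [hA.odd_mul_central_mul_odd h2 hk, LinearMap.smul_apply, smul_smul, e]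
  · intro S h1 h2
    exact hgen S (fun g => h1 (some g)) h2

end SuperStrong

end Strong

end VectorSuper

namespace VectorSuper

universe u v w

open Superalgebra

/-! ### Coordinates on the central extensions -/

section Coordinates

theorem map_monomial {A : Type u} {B : Type v} [NonUnitalNonAssocRing A] [NonUnitalNonAssocRing B]
    (f : A → B) (hf : ∀ a b, f (a * b) = f a * f b) {ι : Type w} (u : ι × ℕ → A) (g : ι × ℕ)
    (L : List (ι × ℕ)) : f (monomial u g L) = monomial (fun h => f (u h)) g L := by
  have key : ∀ (L : List (ι × ℕ)) (a : A),
      f (L.foldl (fun a h => a * u h) a) = L.foldl (fun a h => a * f (u h)) (f a) := by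
    intro L
    induction L with
    | nil => exact fun _ => rfl
    | cons h L ih => exact fun a => by rw [List.foldl_cons, List.foldl_cons, ih, hf]
  exact key L _

variable {Φ : Type u} [Field Φ] {Z : Type v}

theorem shiftD_X (z : Z) (i : ℕ) : shiftD Φ Z (MvPolynomial.X (z, i)) = MvPolynomial.X (z, i + 1) :=
  MvPolynomial.mkDerivation_X _ _ _

theorem VectorType.Rxx_ofOdd_one {Γ : Type w} [CommRing Γ] [Algebra Φ Γ] (D : Derivation Φ Γ Γ)
    (a : Γ) : Rxx (ofOdd D 1) (ofEven D a) = ofEven D (D a) := by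
  rw [Rxx, ofEven_mul_ofOdd, ofOdd_mul_ofOdd, ofOdd_mul_ofOdd, ofEven_mul_ofEven, ← map_sub,
    D.map_one_eq_zero]
  exact congrArg (ofEven D) (by ring_nf)

theorem TwistedType.Rxx_ofOdd_one {Γ : Type w} [CommRing Γ] [Algebra Φ Γ] (D : Derivation Φ Γ Γ)
    (γ a : Γ) : Rxx (ofOdd D γ 1) (ofEven D γ a) = (4 : Φ) • ofEven D γ (D a) := by
  have e : (4 : Φ) • D a = 4 * D a := by
    rw [Algebra.smul_def, map_ofNat]
  rw [Rxx, ofEven_mul_ofOdd, ofOdd_mul_ofOdd, ofOdd_mul_ofOdd, ofEven_mul_ofEven, ← map_sub,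
    ← map_smul, D.map_one_eq_zero, e]
  exact congrArg (ofEven D γ) (by ring_nf)

theorem VectorType.mul_of_snd_eq_zero {Γ : Type w} [CommRing Γ] [Algebra Φ Γ] (D : Derivation Φ Γ Γ)
    {p q : VectorType D} (hp : p.2 = 0) (hq : q.2 = 0) : p * q = (p.1 * q.1, (0 : Γ)) := by
  have ep : p = ofEven D p.1 := Prod.ext rfl hp
  have eq : q = ofEven D q.1 := Prod.ext rfl hq
  exact (congrArg₂ (· * ·) ep eq).trans (ofEven_mul_ofEven D _ _)

theorem VectorType.mul_ofOdd_one {Γ : Type w} [CommRing Γ] [Algebra Φ Γ] (D : Derivation Φ Γ Γ)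
    {p : VectorType D} (hp : p.2 = 0) : p * ofOdd D 1 = ((0 : Γ), p.1) := by
  have ep : p = ofEven D p.1 := Prod.ext rfl hp
  refine (congrArg (· * ofOdd D 1) ep).trans ((ofEven_mul_ofOdd D _ _).trans ?_)
  rw [mul_one]
  rfl

theorem TwistedType.mul_of_snd_eq_zero {Γ : Type w} [CommRing Γ] [Algebra Φ Γ] (D : Derivation Φ Γ Γ)
    (γ : Γ) {p q : TwistedType D γ} (hp : p.2 = 0) (hq : q.2 = 0) : p * q = (p.1 * q.1, (0 : Γ)) := by
  have ep : p = ofEven D γ p.1 := Prod.ext rfl hp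
  have eq : q = ofEven D γ q.1 := Prod.ext rfl hq
  exact (congrArg₂ (· * ·) ep eq).trans (ofEven_mul_ofEven D γ _ _)

theorem TwistedType.mul_ofOdd_one {Γ : Type w} [CommRing Γ] [Algebra Φ Γ] (D : Derivation Φ Γ Γ)
    (γ : Γ) {p : TwistedType D γ} (hp : p.2 = 0) : p * ofOdd D γ 1 = ((0 : Γ), p.1) := by
  have ep : p = ofEven D γ p.1 := Prod.ext rfl hp
  refine (congrArg (· * ofOdd D γ 1) ep).trans ((ofEven_mul_ofOdd D γ _ _).trans ?_)
  rw [mul_one]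
  rfl

/-- Both structure results meet here: the universal property gives the map, and the decomposition L
+ Lx + Φx together with the freeness of the variables gives its injectivity and its image. -/
theorem exists_jordanExt_coordinates (h2 : (2 : Φ) ≠ 0) (h3 : (3 : Φ) ≠ 0) (Z : Type v) :
    ∃ φ : JordanExt Φ Z →ₗ[Φ] VectorType (shiftD Φ Z), IsSuperHom φ ∧
      φ (JordanExt.x Φ Z) = VectorType.ofOdd _ 1 ∧
      (∀ h : Z × ℕ, φ ((Rxx (JordanExt.x Φ Z))^[h.2] (JordanExt.z Φ h.1)) =
        VectorType.ofEven _ (MvPolynomial.X h)) ∧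
      Function.Injective φ ∧ (∀ a, MvPolynomial.constantCoeff (φ a).1 = 0) ∧
      ∀ p q, MvPolynomial.constantCoeff p = 0 → ∃ a, φ a = (p, q) := by
  obtain ⟨φ, hφ, hz, hx⟩ := exists_jordanExt_lift h3 (VectorType.superJordan (shiftD Φ Z))
    (fun z => VectorType.ofEven _ (MvPolynomial.X (z, 0))) (VectorType.ofOdd _ 1)
    (fun _ => VectorType.ofEven_mem _ _) (VectorType.ofOdd_mem _ _)
    (fun _ _ _ _ _ ha hb => VectorType.assoc_ofEven_skew _ _ ha hb)
  have hu : ∀ h : Z × ℕ, φ ((Rxx (JordanExt.x Φ Z))^[h.2] (JordanExt.z Φ h.1)) =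
      VectorType.ofEven _ (MvPolynomial.X h) := by
    rintro ⟨z, n⟩
    induction n with
    | zero => exact hz z
    | succ n ih =>
      dsimp only at ih ⊢
      rw [Function.iterate_succ_apply', Rxx, map_sub, hφ.map_mul, hφ.map_mul, hφ.map_mul,
        hφ.map_mul, hx, ih, ← shiftD_X]
      exact VectorType.Rxx_ofOdd_one _ _
  obtain ⟨hcomm, hassoc, hdec⟩ := (superJordan_jordanExt (Z := Z) h2).skew_generated h2 h3
    (z := JordanExt.z Φ) (fun z => ⟨jordanExt_z_mem z, fun i j a b => jordanExt_relation z⟩)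
    jordanExt_x_mem (fun S hz hx => by
      rw [eq_top_iff]
      intro p _
      induction p using jordanExt_induction with
      | z g => exact hz g
      | x => exact hx
      | add p q hp hq => exact add_mem (hp trivial) (hq trivial)
      | smul c p hp => exact SMulMemClass.smul_mem c (hp trivial)
      | mul p q hp hq => exact S.mul_mem (hp trivial) (hq trivial)
      | zero => exact zero_mem S)
  refine ⟨φ, hφ, hx, hu, bijective_of_map_eq_X hcomm hassoc hdec φ hu hx ?_ ?_⟩
  · exact fun a b ha hb => (hφ.map_mul a b).trans (VectorType.mul_of_snd_eq_zero _ ha hb)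
  · exact fun a ha => (hφ.map_mul a _).trans (hx ▸ VectorType.mul_ofOdd_one _ ha)

/-- Taking γ to be the variable with index (`none`, 0) makes x² a further free differential
variable, so F[Z;x] is described by polynomials over one more symbol than Z. -/
theorem exists_strongExt_coordinates (h2 : (2 : Φ) ≠ 0) (h3 : (3 : Φ) ≠ 0) (Z : Type v) :
    ∃ φ : StrongExt Φ Z →ₗ[Φ] TwistedType (shiftD Φ (Option Z)) (MvPolynomial.X (none, 0)),
      IsSuperHom φ ∧ φ (StrongExt.x Φ Z) = TwistedType.ofOdd _ _ 1 ∧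
      (∀ h : Option Z × ℕ, φ ((fun a => (4⁻¹ : Φ) • Rxx (StrongExt.x Φ Z) a)^[h.2]
        (h.1.elim (StrongExt.x Φ Z * StrongExt.x Φ Z) (StrongExt.z Φ))) =
          TwistedType.ofEven _ _ (MvPolynomial.X h)) ∧
      Function.Injective φ ∧ (∀ a, MvPolynomial.constantCoeff (φ a).1 = 0) ∧
      ∀ p q, MvPolynomial.constantCoeff p = 0 → ∃ a, φ a = (p, q) := by
  obtain ⟨φ, hφ, hz, hx⟩ := exists_strongExt_lift h2
    (TwistedType.superStrong (shiftD Φ (Option Z)) (MvPolynomial.X (none, 0)))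
    (fun z : Z => TwistedType.ofEven _ _ (MvPolynomial.X (some z, 0))) (TwistedType.ofOdd _ _ 1)
    (fun _ => TwistedType.ofEven_mem _ _ _) (TwistedType.ofOdd_mem _ _ _)
    (fun _ _ => TwistedType.ofEven_mul_comm _ _ _ _)
  have h4 : (4 : Φ) ≠ 0 := by
    have e : (4 : Φ) = 2 * 2 := by norm_num
    rw [e]
    exact mul_ne_zero h2 h2
  have hu : ∀ h : Option Z × ℕ, φ ((fun a => (4⁻¹ : Φ) • Rxx (StrongExt.x Φ Z) a)^[h.2]
        (h.1.elim (StrongExt.x Φ Z * StrongExt.x Φ Z) (StrongExt.z Φ))) =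
          TwistedType.ofEven _ _ (MvPolynomial.X h) := by
    rintro ⟨z, n⟩
    induction n with
    | zero =>
      rcases z with _ | z
      · refine (hφ.map_mul _ _).trans ?_
        rw [hx, TwistedType.ofOdd_mul_ofOdd, Derivation.map_one_eq_zero]
        exact congrArg (TwistedType.ofEven _ _) (by ring)
      · exact hz z
    | succ n ih =>
      dsimp only at ih ⊢
      rw [Function.iterate_succ_apply', map_smul, Rxx, map_sub, hφ.map_mul, hφ.map_mul,
        hφ.map_mul, hφ.map_mul, hx, ih, inv_smul_eq_iff₀ h4, ← shiftD_X]
      exact TwistedType.Rxx_ofOdd_one _ _ _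
  obtain ⟨hcomm, hassoc, hdec⟩ := (superStrong_strongExt (Φ := Φ) (Z := Z)).central_generated h2 h3
    (z := fun g => g.elim (StrongExt.x Φ Z * StrongExt.x Φ Z) (StrongExt.z Φ))
    (fun z => ⟨strongExt_z_mem z, strongExt_relation z⟩)
    strongExt_x_mem rfl (fun S hz hx => by
      rw [eq_top_iff]
      intro p _
      induction p using strongExt_induction with
      | z g => exact hz g
      | x => exact hx
      | add p q hp hq => exact add_mem (hp trivial) (hq trivial)
      | smul c p hp => exact SMulMemClass.smul_mem c (hp trivial)
      | mul p q hp hq => exact S.mul_mem (hp trivial) (hq trivial)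
      | zero => exact zero_mem S)
  refine ⟨φ, hφ, hx, hu, bijective_of_map_eq_X hcomm hassoc hdec φ hu hx ?_ ?_⟩
  · exact fun a b ha hb => (hφ.map_mul a b).trans (TwistedType.mul_of_snd_eq_zero _ _ ha hb)
  · exact fun a ha => (hφ.map_mul a _).trans (hx ▸ TwistedType.mul_ofOdd_one _ _ ha)

end Coordinates

/-! ### The symmetrized twisted product -/

section Symmetrization

variable {Φ : Type u} {Γ : Type v} [Field Φ] [CommRing Γ] [Algebra Φ Γ] (D : Derivation Φ Γ Γ)
  (γ : Γ)

theorem TwistedType.oddPart_eq (p : TwistedType D γ) :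
    oddPart Φ (TwistedType D γ) p = ofOdd D γ p.2 := by
  have e : p = ofEven D γ p.1 + ofOdd D γ p.2 :=
    Prod.ext (add_zero p.1).symm (zero_add p.2).symm
  conv_lhs => rw [e, map_add, oddPart_of_even (ofEven_mem D γ _), oddPart_of_odd (ofOdd_mem D γ _),
    zero_add]

/-- The symmetrized product of the strongly (-1,1)-superalgebra of vector type is the product of
the Jordan superalgebra of vector type. -/
theorem TwistedType.symmetrized_mul (h2 : (2 : Φ) ≠ 0) (p q : TwistedType D γ) :
    (2⁻¹ : Φ) • (p * q + q * p - (2 : Φ) • (oddPart Φ _ q * oddPart Φ _ p)) =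
      (p.1 * q.1 + (D p.2 * q.2 - p.2 * D q.2), p.1 * q.2 + p.2 * q.1) := by
  rw [oddPart_eq, oddPart_eq, ofOdd_mul_ofOdd]
  refine (inv_smul_eq_iff₀ h2).2 (Prod.ext ?_ ?_)
  · change p.1 * q.1 + (γ * p.2 * q.2 + 4 * D p.2 * q.2 + 2 * p.2 * D q.2) +
        (q.1 * p.1 + (γ * q.2 * p.2 + 4 * D q.2 * p.2 + 2 * q.2 * D p.2)) -
        (2 : Φ) • (γ * q.2 * p.2 + 4 * D q.2 * p.2 + 2 * q.2 * D p.2) =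
      (2 : Φ) • (p.1 * q.1 + (D p.2 * q.2 - p.2 * D q.2))
    rw [two_smul, two_smul]
    ring
  · change p.1 * q.2 + p.2 * q.1 + (q.1 * p.2 + q.2 * p.1) - (2 : Φ) • (0 : Γ) =
      (2 : Φ) • (p.1 * q.2 + p.2 * q.1)
    rw [two_smul, two_smul]
    ring

theorem Plus.mem_grade_iff {A : Type w} [NonUnitalNonAssocRing A] [Module Φ A] [Superalgebra Φ A]
    (i : ZMod 2) (a : A) :
    toPlus Φ A a ∈ grade (Φ := Φ) (A := Plus Φ A) i ↔ a ∈ grade (Φ := Φ) i := by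
  constructor
  · rintro ⟨b, hb, e⟩
    rwa [← (toPlus Φ A).injective e]
  · exact fun h => ⟨a, h, rfl⟩

end Symmetrization

/-! ### The isomorphisms -/

section Isomorphisms

variable {Φ : Type u} [Field Φ] (h2 : (2 : Φ) ≠ 0) (h3 : (3 : Φ) ≠ 0) (Z : Type v)
include h2 h3

theorem exists_jordanExt_superIso_vectorSub :
    ∃ e : SuperIso Φ (JordanExt Φ Z) (vectorSub Φ Z),
      (∀ z : Z, e.toLinearEquiv (JordanExt.z Φ z) = vectorSub.z Φ Z z) ∧
        e.toLinearEquiv (JordanExt.x Φ Z) = vectorSub.oneBar Φ Z := by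
  obtain ⟨φ, hφ, hx, hu, hinj, hconst, hsurj⟩ := exists_jordanExt_coordinates h2 h3 Z
  let f : JordanExt Φ Z →ₗ[Φ] vectorSub Φ Z :=
    { toFun := fun a => ⟨φ a, hconst a⟩
      map_add' := fun a b => Subtype.ext (map_add φ a b)
      map_smul' := fun c a => Subtype.ext (map_smul φ c a) }
  have hf : Function.Bijective f := by
    refine ⟨fun a b h => hinj (congrArg Subtype.val h), ?_⟩
    rintro ⟨⟨p, q⟩, hp⟩
    obtain ⟨a, ha⟩ := hsurj p q hp
    exact ⟨a, Subtype.ext ha⟩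
  refine ⟨{ toLinearEquiv := LinearEquiv.ofBijective f hf
            map_mul' := fun a b => Subtype.ext (hφ.map_mul a b)
            map_grade' := hφ.mem_grade_iff hinj }, fun z => Subtype.ext (hu (z, 0)),
    Subtype.ext hx⟩

/-- The isomorphism is the Jordan coordinate map followed by the inverse of the strongly (-1,1) one.
It matches monomials because u_{g,i} and v_{g,i} have the same variable as coordinate. -/
theorem exists_jordanExt_superIso_plus :
    ∃ e : SuperIso Φ (JordanExt Φ (Option Z)) (Plus Φ (StrongExt Φ Z)),
      let x := JordanExt.x Φ (Option Z)
      let y := StrongExt.x Φ Z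
      let u : Option Z × ℕ → JordanExt Φ (Option Z) := fun h =>
        (Rxx x)^[h.2] (JordanExt.z Φ h.1)
      let v : Option Z × ℕ → StrongExt Φ Z := fun h =>
        (fun a => (4⁻¹ : Φ) • Rxx y a)^[h.2] (h.1.elim (y * y) (StrongExt.z Φ))
      e.toLinearEquiv x = toPlus Φ _ y ∧
      ∀ (g : Option Z × ℕ) (L : List (Option Z × ℕ)),
        e.toLinearEquiv (monomial u g L) = toPlus Φ _ (monomial v g L) ∧
        e.toLinearEquiv (monomial u g L * x) = toPlus Φ _ (monomial v g L * y) := by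
  obtain ⟨φ, hφ, hx, hu, hinj, hconst, hsurj⟩ := exists_jordanExt_coordinates h2 h3 (Option Z)
  obtain ⟨χ, hχ, hy, hv, hinj', hconst', hsurj'⟩ := exists_strongExt_coordinates h2 h3 Z
  -- The two models share their vector space and differ only in the product; as linear maps into
  -- that space, φ and χ can be compared.
  let φ' : JordanExt Φ (Option Z) →ₗ[Φ] DiffPoly Φ (Option Z) × DiffPoly Φ (Option Z) := φ
  let χ' : StrongExt Φ Z →ₗ[Φ] DiffPoly Φ (Option Z) × DiffPoly Φ (Option Z) := χ
  have hrange : LinearMap.range φ' = LinearMap.range χ' := by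
    apply le_antisymm
    · rintro _ ⟨a, rfl⟩
      exact hsurj' (φ' a).1 (φ' a).2 (hconst a)
    · rintro _ ⟨a, rfl⟩
      exact hsurj (χ' a).1 (χ' a).2 (hconst' a)
  let E : JordanExt Φ (Option Z) ≃ₗ[Φ] StrongExt Φ Z :=
    (LinearEquiv.ofInjective φ' hinj).trans
      ((LinearEquiv.ofEq _ _ hrange).trans (LinearEquiv.ofInjective χ' hinj').symm)
  have hE : ∀ a, χ' (E a) = φ' a := fun a =>
    congrArg Subtype.val ((LinearEquiv.ofInjective χ' hinj').apply_symm_apply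
      (LinearEquiv.ofEq _ _ hrange (LinearEquiv.ofInjective φ' hinj a)))
  have hmon : ∀ g L, φ' (monomial (fun h => (Rxx (JordanExt.x Φ (Option Z)))^[h.2]
      (JordanExt.z Φ h.1)) g L) = (monomial (fun h => MvPolynomial.X h) g L, 0) := by
    intro g L
    refine (map_monomial φ hφ.map_mul _ g L).trans ?_
    simp only [hu]
    exact (map_monomial (VectorType.ofEven (shiftD Φ (Option Z)))
      (fun a b => (VectorType.ofEven_mul_ofEven _ a b).symm) (fun h => MvPolynomial.X h) g L).symm
  have hmon' : ∀ g L, χ' (monomial (fun h => (fun a => (4⁻¹ : Φ) • Rxx (StrongExt.x Φ Z) a)^[h.2]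
      (h.1.elim (StrongExt.x Φ Z * StrongExt.x Φ Z) (StrongExt.z Φ))) g L) =
        (monomial (fun h => MvPolynomial.X h) g L, 0) := by
    intro g L
    refine (map_monomial χ hχ.map_mul _ g L).trans ?_
    simp only [hv]
    exact (map_monomial (TwistedType.ofEven (shiftD Φ (Option Z)) (MvPolynomial.X (none, 0)))
      (fun a b => (TwistedType.ofEven_mul_ofEven _ _ a b).symm)
      (fun h => MvPolynomial.X h) g L).symm
  refine ⟨{ toLinearEquiv := E.trans (toPlus Φ _)
            map_mul' := fun a b => ?_
            map_grade' := fun i a => ?_ }, ?_, fun g L => ⟨?_, ?_⟩⟩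
  -- In coordinates the right side is the symmetrized twisted product, which is the product of the
  -- Jordan model.
  · have key : E (a * b) = (2⁻¹ : Φ) • (E a * E b + E b * E a -
        (2 : Φ) • (oddPart Φ _ (E b) * oddPart Φ _ (E a))) := by
      apply hinj'
      have ea : χ (E a) = φ a := hE a
      have eb : χ (E b) = φ b := hE b
      rw [map_smul, map_sub, map_add, map_smul, hχ.map_mul, hχ.map_mul, hχ.map_mul,
        hχ.map_oddPart, hχ.map_oddPart, TwistedType.symmetrized_mul _ _ h2, ea, eb]
      exact (hE (a * b)).trans (hφ.map_mul a b)
    exact congrArg (toPlus Φ (StrongExt Φ Z)) key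
  · rw [hφ.mem_grade_iff hinj]
    refine Iff.trans ?_ (Plus.mem_grade_iff i (E a)).symm
    rw [hχ.mem_grade_iff hinj']
    have ea : χ (E a) = φ a := hE a
    rw [ea]
    rfl
  · refine congrArg (toPlus Φ (StrongExt Φ Z)) (hinj' ?_)
    exact (hE _).trans (hx.trans hy.symm)
  · refine congrArg (toPlus Φ (StrongExt Φ Z)) (hinj' ?_)
    exact (hE _).trans ((hmon g L).trans (hmon' g L).symm)
  · refine congrArg (toPlus Φ (StrongExt Φ Z)) (hinj' ?_)
    refine (hE _).trans ((hφ.map_mul _ _).trans ?_)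
    rw [hχ.map_mul, hx, hy]
    refine (congrArg (fun p : VectorType _ => p * VectorType.ofOdd _ 1) (hmon g L)).trans ?_
    refine Eq.trans ?_ (congrArg (fun p : TwistedType _ _ => p * TwistedType.ofOdd _ _ 1)
      (hmon' g L)).symm
    -- Right multiplication by 1̄ sends an even element to its odd copy in both models.
    exact (VectorType.mul_ofOdd_one _ rfl).trans (TwistedType.mul_ofOdd_one _ _ rfl).symm

end Isomorphisms

end VectorSuper

end

theorem proposition7p6 (Φ : Type*) [Field Φ] (h2 : (2 : Φ) ≠ 0) (h3 : (3 : Φ) ≠ 0) (Z : Type*) :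
    (Nonempty Z →
      ∃ e : VectorSuper.SuperIso Φ (VectorSuper.JordanExt Φ Z) (VectorSuper.vectorSub Φ Z),
        (∀ z : Z, e.toLinearEquiv (VectorSuper.JordanExt.z Φ z) = VectorSuper.vectorSub.z Φ Z z) ∧
        e.toLinearEquiv (VectorSuper.JordanExt.x Φ Z) = VectorSuper.vectorSub.oneBar Φ Z) ∧
    (∃ e : VectorSuper.SuperIso Φ (VectorSuper.JordanExt Φ (Option Z))
        (VectorSuper.Plus Φ (VectorSuper.StrongExt Φ Z)),
      let x := VectorSuper.JordanExt.x Φ (Option Z)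
      let y := VectorSuper.StrongExt.x Φ Z
      let u : Option Z × ℕ → VectorSuper.JordanExt Φ (Option Z) := fun h =>
        (VectorSuper.Rxx x)^[h.2] (VectorSuper.JordanExt.z Φ h.1)
      let v : Option Z × ℕ → VectorSuper.StrongExt Φ Z := fun h =>
        (fun a => (4⁻¹ : Φ) • VectorSuper.Rxx y a)^[h.2]
          (h.1.elim (y * y) (VectorSuper.StrongExt.z Φ))
      e.toLinearEquiv x = VectorSuper.toPlus Φ _ y ∧
      ∀ (g : Option Z × ℕ) (L : List (Option Z × ℕ)),
        e.toLinearEquiv (VectorSuper.monomial u g L) =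
          VectorSuper.toPlus Φ _ (VectorSuper.monomial v g L) ∧
        e.toLinearEquiv (VectorSuper.monomial u g L * x) =
          VectorSuper.toPlus Φ _ (VectorSuper.monomial v g L * y)) :=
  ⟨fun _ => VectorSuper.exists_jordanExt_superIso_vectorSub h2 h3 Z,
    VectorSuper.exists_jordanExt_superIso_plus h2 h3 Z⟩
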